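/- **Setting.** Let $F=f+g$ on $\mathbb R^n$ with $f,g:\mathbb R^n\to\mathbb R\cup\{\infty\}$. *Assumption 1.* $f$ is finite and twice differentiable on an open set $\mathcal O\supset\operatorname{dom}g$; $\nabla f$ is Lipschitz on $\mathcal O$ with constant $L>0$ and $\nabla^2 f$ is Lipschitz on $\mathcal O$; $g$ is proper and lsc; $\inf F>-\infty$. *Assumption 2.* $g$ is prox-regular at every point of $\operatorname{dom}g$ (for every limiting subgradient) and prox-bounded with threshold $\gamma_g\ge 1/L$. For $\gamma>0$ let $\mathcal P_\gamma g(x)=\arg\min_z\{\frac1{2\gamma}\|z-x\|^2+g(z)\}$, $\mathcal T_\gamma(x)=\mathcal P_\gamma g(x-\gamma\nabla f(x))$, $\mathcal R_\gamma(x)=\gamma^{-1}(x-\mathcal T_\gamma(x))$, $Q_\gamma(x)=I-\gamma\nabla^2 f(x)$ and $$F_\gamma(x)=\inf_z\Big\{f(x)+\langle\nabla f(x),z-x\rangle+\tfrac1{2\gamma}\|z-x\|^2+g(z)\Big\},\qquad x\in\mathcal O.$$ Where $\mathcal P_\gamma g$ is single-valued and Lipschitz around $x-\gamma\nabla f(x)$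 and $Q_\gamma(x)$ is nonsingular, let $\partial^2F_\gamma(x)=\{\gamma^{-1}Q_\gamma(x)(I-WQ_\gamma(x)) : W\in\partial_C\mathcal P_\gamma g(x-\gamma\nabla f(x))\}$, where $\partial_C$ is the Clarke generalized Jacobian. **Algorithm.** Let $\beta\in(0,1)$, $\alpha>0$, $\overline\gamma\ge\frac1{L+\alpha}$, $\widetilde L=L+2\alpha$, $\tau\in(0,1)$, $\varrho\in(0,1-\tau)$, $0<\underline\varsigma<\overline\varsigma$, $0<\underline\sigma<\overline\sigma$, $y^0\in\mathcal O$. For $k=0,1,\dots$: (1) choose $\gamma_k\in[\frac1{L+\alpha},\overline\gamma]$ and $x^k\in\mathcal T_{\gamma_k}(y^k)$ with $F(x^k)\le F_{\gamma_k}(y^k)-\frac\alpha2\|x^k-y^k\|^2$; stop if $x^k=y^k$. (2a) $\widetilde\gamma_k=\widetilde L^{-1}\beta^{m_k}$, with $m_k$ the least $m\ge0$ such that $\mathcal T_{\widetilde L^{-1}\beta^m}$ is single-valued and Lipschitz around $x^k$. (2b) $\mu_k=\|\mathcal R_{\widetilde\gamma_k}(x^k)\|^\tau$; choose $H_k\in\partial^2F_{\widetilde\gamma_k}(x^k)$,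 $\sigma_k\in[\underline\sigma,\overline\sigma]$, $\varsigma_k\in[\underline\varsigma,\overline\varsigma]$, and let $d^k$ be a global minimizer of $\frac12d^\top(H_k+\mu_k\sigma_kI)d+(Q_{\widetilde\gamma_k}(x^k)\mathcal R_{\widetilde\gamma_k}(x^k))^\top d$ subject to $\|d\|\le\varsigma_k\|\mathcal R_{\widetilde\gamma_k}(x^k)\|^\varrho$. (2c) $y^{k+1}=\beta^{l_k}(x^k+d^k)+(1-\beta^{l_k})\mathcal T_{\widetilde\gamma_k}(x^k)$, with $l_k$ the least $l\ge0$ for which the point $y=\beta^{l}(x^k+d^k)+(1-\beta^{l})\mathcal T_{\widetilde\gamma_k}(x^k)$ lies in $\mathcal O$ and satisfies $F_{\widetilde\gamma_k}(y)\le F_{\widetilde\gamma_k}(x^k)-\frac{\widetilde\gamma_k-\widetilde\gamma_k^2L}{4}\|\mathcal R_{\widetilde\gamma_k}(x^k)\|^2$. Suppose that the algorithm does not stop, so that infinite sequences are generated. Write $F_*,\mathcal R_*$ for $F_{\widetilde L^{-1}},\mathcal R_{\widetilde L^{-1}}$ and $\mathcal X^*=\{x: 0\in\mathcal R_*(x)\}$;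 $\mathbb B(x,r)$ is the closed ball. *Assumption 3.* $\{x^k\}$ is bounded. *Assumption 4.* (i) $x^k\to x^*\in\mathcal X^*$, a local minimum of $F$. (ii) There are $\varepsilon,\kappa>0$ with $\operatorname{dist}(x,\mathcal X^*)\le\kappa\operatorname{dist}(0,\mathcal R_*(x))$ for all $x\in\mathbb B(x^*,\varepsilon)\cap\mathcal O$. (iii) There is $\overline\varepsilon\in(0,\varepsilon)$ with $F_*(x)=F_*(x^*)$ for all $x\in\mathbb B(x^*,\overline\varepsilon)\cap\mathcal X^*$. *Conditions.* (C1) There are $\varepsilon_1,\kappa_1>0$, $\rho_1\in(\tau,1]$ such that for all $x\in\mathbb B(x^*,\varepsilon_1)\cap\mathcal O$, every projection $\overline x$ of $x$ onto $\mathcal X^*$ and every $H\in\partial^2F_*(x)$ there is $\overline H\in\partial^2F_*(\overline x)$ with $\|H-\overline H\|_2\le\kappa_1\|x-\overline x\|^{\rho_1}$. (C2) There is $\delta>0$ such that $H\succeq0$ for all $H\in\partial^2F_*(x)$, $x\in\mathcal X^*\cap\mathbb B(x^*,\delta)$. (C3) There are $\varepsilon_2,\kappa_2>0$, $\rho_2\in[\tau,1]$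 such that $\mathcal R_*$ is single-valued and locally Lipschitz at every point of $\mathbb B(x^*,\varepsilon_2)\cap\mathcal O$ and $\|\mathcal R_*(y)-\mathcal R_*(x)-J(y-x)\|\le\kappa_2\|y-x\|^{1+\rho_2}$ for all $x,y\in\mathbb B(x^*,\varepsilon_2)\cap\mathcal O$ and $J\in\partial_C\mathcal R_*(x)$. **Theorem.** Under Assumptions 1–4 and (C1)–(C3) there are $\widetilde c,\widetilde c_2>0$ and $\overline k$ such that for all $k>\overline k$ the distances $\operatorname{dist}(x^k,\mathcal X^*)$ and $\operatorname{dist}(y^k,\mathcal X^*)$ are positive, $\operatorname{dist}(x^k+d^k,\mathcal X^*)\le\widetilde c\,\operatorname{dist}(x^k,\mathcal X^*)^{1+\tau}$, $l_k=0$ (the unit step is accepted), and $\operatorname{dist}(y^{k+1},\mathcal X^*)\le\widetilde c_2\operatorname{dist}(y^k,\mathcal X^*)^{1+\tau}$. Consequently $$\lim_{k\to\infty}\frac{\operatorname{dist}(x^k+d^k,\mathcal X^*)}{\operatorname{dist}(x^k,\mathcal X^*)}=0$$ (the $d^k$ are superlinear directions), $\operatorname{dist}(y^k,\mathcal X^*)\to0$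 and $\operatorname{dist}(y^{k+1},\mathcal X^*)/\operatorname{dist}(y^k,\mathcal X^*)\to0$. -/

import Mathlib

open Filter Topology

noncomputable section

namespace PGSSN

/-- `ℝⁿ` with the Euclidean norm. -/
abbrev E (n : ℕ) : Type := EuclideanSpace ℝ (Fin n)

section VariationalAnalysis

variable {n : ℕ}

/-- Effective domain of an extended real-valued function. -/
def dom (h : E n → EReal) : Set (E n) := {x | h x < ⊤}

/-- Proper: never `-∞`, and not identically `+∞`. -/
def Proper (h : E n → EReal) : Prop := (∀ x, h x ≠ ⊥) ∧ ∃ x, h x ≠ ⊤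

/-- The function `z ↦ (2γ)⁻¹ ‖z - x‖² + h z`. -/
def proxObj (γ : ℝ) (h : E n → EReal) (x z : E n) : EReal :=
  (((2 * γ)⁻¹ * ‖z - x‖ ^ 2 : ℝ) : EReal) + h z

/-- The (set-valued) proximal mapping `P_γ h`. -/
def prox (γ : ℝ) (h : E n → EReal) (x : E n) : Set (E n) :=
  {z | ∀ w, proxObj γ h x z ≤ proxObj γ h x w}

/-- The Moreau envelope `e_γ h`. -/
def moreau (γ : ℝ) (h : E n → EReal) (x : E n) : EReal := ⨅ z, proxObj γ h x z

/-- The parameters `γ > 0` for which the Moreau envelope is `> -∞` at some point. -/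
def proxBoundedSet (h : E n → EReal) : Set ℝ := {γ | 0 < γ ∧ ∃ x, ⊥ < moreau γ h x}

def ProxBounded (h : E n → EReal) : Prop := (proxBoundedSet h).Nonempty

/-- Threshold of prox-boundedness (it may be `+∞`). -/
def proxThreshold (h : E n → EReal) : EReal :=
  sSup ((fun γ : ℝ => (γ : EReal)) '' proxBoundedSet h)

/-- Regular (Fréchet) subdifferential at a point where `h` is finite. -/
def regSubdiff (h : E n → EReal) (x : E n) : Set (E n) :=
  {v | h x ≠ ⊥ ∧ h x ≠ ⊤ ∧ ∀ ε : ℝ, 0 < ε →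
    ∀ᶠ z in 𝓝 x, h x + ((inner ℝ v (z - x) - ε * ‖z - x‖ : ℝ) : EReal) ≤ h z}

/-- Limiting (Mordukhovich) subdifferential at a point where `h` is finite. -/
def limSubdiff (h : E n → EReal) (x : E n) : Set (E n) :=
  {v | h x ≠ ⊥ ∧ h x ≠ ⊤ ∧ ∃ (u w : ℕ → E n),
    Tendsto u atTop (𝓝 x) ∧ Tendsto (fun j => h (u j)) atTop (𝓝 (h x)) ∧
    (∀ j, w j ∈ regSubdiff h (u j)) ∧ Tendsto w atTop (𝓝 v)}

/-- Local lower semicontinuity at a point where `h` is finite. -/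
def LocallyLsc (h : E n → EReal) (x₀ : E n) : Prop :=
  ∃ ε : ℝ, 0 < ε ∧ ∀ a : ℝ, (a : EReal) ≤ h x₀ + (ε : EReal) →
    IsClosed {x | x ∈ Metric.closedBall x₀ ε ∧ h x ≤ (a : EReal)}

/-- Prox-regularity of `h` at `x₀` for `v₀`. -/
def ProxRegularAtFor (h : E n → EReal) (x₀ v₀ : E n) : Prop :=
  LocallyLsc h x₀ ∧
  ∃ ρ ε : ℝ, 0 ≤ ρ ∧ 0 < ε ∧
    ∀ x v, v ∈ limSubdiff h x → ‖x - x₀‖ < ε → ‖v - v₀‖ < ε → h x < h x₀ + (ε : EReal) →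
      ∀ x', ‖x' - x₀‖ ≤ ε →
        h x + ((inner ℝ v (x' - x) - ρ / 2 * ‖x' - x‖ ^ 2 : ℝ) : EReal) ≤ h x'

/-- Prox-regularity of `h` at `x₀`, i.e. for every limiting subgradient at `x₀`. -/
def ProxRegularAt (h : E n → EReal) (x₀ : E n) : Prop :=
  ∀ v ∈ limSubdiff h x₀, ProxRegularAtFor h x₀ v

/-- The multifunction `S` is single-valued and Lipschitz continuous on a neighbourhood of `x`. -/
def LocSingleLip (S : E n → Set (E n)) (x : E n) : Prop :=
  ∃ r K : ℝ, 0 < r ∧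
    (∀ u ∈ Metric.ball x r, ∃! z, z ∈ S u) ∧
    ∀ u ∈ Metric.ball x r, ∀ v ∈ Metric.ball x r, ∀ z ∈ S u, ∀ w ∈ S v,
      ‖z - w‖ ≤ K * ‖u - v‖

/-- A multifunction read as a function: where `S` is single-valued this is its value.
It is only used at points around which `S` is single-valued. -/
def val (S : E n → Set (E n)) (x : E n) : E n :=
  open Classical in if h : (S x).Nonempty then h.some else 0

/-- `B`-subdifferential: limits of Jacobians at nearby points of differentiability. -/
def bSubdiff (H : E n → E n) (x : E n) : Set (E n →L[ℝ] E n) :=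
  {V | ∃ (u : ℕ → E n) (D : ℕ → (E n →L[ℝ] E n)),
    Tendsto u atTop (𝓝 x) ∧ (∀ j, HasFDerivAt H (D j) (u j)) ∧ Tendsto D atTop (𝓝 V)}

/-- Clarke generalized Jacobian. -/
def clarke (H : E n → E n) (x : E n) : Set (E n →L[ℝ] E n) := convexHull ℝ (bSubdiff H x)

/-- The set of projections of `x` onto `D`. -/
def projSet (D : Set (E n)) (x : E n) : Set (E n) := {z | z ∈ D ∧ ‖x - z‖ = Metric.infDist x D}

end VariationalAnalysis

section Composite

variable {n : ℕ}

/-- The objective `F = f + g`. -/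
def objective (f g : E n → EReal) (x : E n) : EReal := f x + g x

/-- `∇f`; used only on the open set where `f` is finite and differentiable. -/
def grad (f : E n → EReal) (x : E n) : E n := gradient (fun u => (f u).toReal) x

/-- `∇²f`, as a linear operator. -/
def hess (f : E n → EReal) (x : E n) : E n →L[ℝ] E n := fderiv ℝ (grad f) x

/-- `T_γ(x) = P_γ g (x - γ ∇f(x))`. -/
def fbStep (f g : E n → EReal) (γ : ℝ) (x : E n) : Set (E n) := prox γ g (x - γ • grad f x)

/-- `R_γ(x) = γ⁻¹ (x - T_γ(x))`. -/
def residual (f g : E n → EReal) (γ : ℝ) (x : E n) : Set (E n) :=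
  (fun z => γ⁻¹ • (x - z)) '' fbStep f g γ x

/-- Forward-backward envelope `F_γ`. -/
def fbe (f g : E n → EReal) (γ : ℝ) (x : E n) : EReal :=
  ⨅ z, ((((f x).toReal + inner ℝ (grad f x) (z - x) + (2 * γ)⁻¹ * ‖z - x‖ ^ 2 : ℝ) : EReal) + g z)

/-- `Q_γ(x) = I - γ ∇²f(x)`. -/
def Q (f : E n → EReal) (γ : ℝ) (x : E n) : E n →L[ℝ] E n :=
  ContinuousLinearMap.id ℝ (E n) - γ • hess f x

/-- `∂²F_γ(x) = {γ⁻¹ Q_γ(x) (I - W Q_γ(x)) | W ∈ ∂_C P_γ g (x - γ ∇f(x))}`, defined where `P_γ g`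
is single-valued and Lipschitz around `x - γ ∇f(x)` and `Q_γ(x)` is nonsingular
(empty elsewhere). -/
def genHess (f g : E n → EReal) (γ : ℝ) (x : E n) : Set (E n →L[ℝ] E n) :=
  {H | LocSingleLip (prox γ g) (x - γ • grad f x) ∧ IsUnit (Q f γ x) ∧
    ∃ W ∈ clarke (val (prox γ g)) (x - γ • grad f x),
      H = γ⁻¹ • (Q f γ x ∘L (ContinuousLinearMap.id ℝ (E n) - W ∘L Q f γ x))}

/-- The set `{x | 0 ∈ R_γ(x)}`. -/
def zeroSet (f g : E n → EReal) (γ : ℝ) : Set (E n) := {x | (0 : E n) ∈ residual f g γ x}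

/-- Standing assumptions on `f` and `g`: `f` is finite and twice differentiable on the open set
`O ⊇ dom g`, with `∇f` `L`-Lipschitz and `∇²f` Lipschitz on `O`; `g` is proper and lsc;
`f + g` is bounded below. -/
structure BasicAssumptions (f g : E n → EReal) (O : Set (E n)) (L : ℝ) : Prop where
  isOpen : IsOpen O
  dom_subset : dom g ⊆ O
  f_ne_bot : ∀ x, f x ≠ ⊥
  f_ne_top : ∀ x ∈ O, f x ≠ ⊤
  f_diff : ∀ x ∈ O, DifferentiableAt ℝ (fun u => (f u).toReal) x
  grad_diff : ∀ x ∈ O, DifferentiableAt ℝ (grad f) x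
  L_pos : 0 < L
  grad_lip : ∀ x ∈ O, ∀ y ∈ O, ‖grad f x - grad f y‖ ≤ L * ‖x - y‖
  hess_lip : ∃ K : ℝ, ∀ x ∈ O, ∀ y ∈ O, ‖hess f x - hess f y‖ ≤ K * ‖x - y‖
  g_proper : Proper g
  g_lsc : LowerSemicontinuous g
  bddBelow : ∃ b : ℝ, ∀ x, (b : EReal) ≤ objective f g x

/-- `g` is prox-regular on `dom g` and prox-bounded with threshold at least `1/L`. -/
structure ProxAssumptions (g : E n → EReal) (L : ℝ) : Prop where
  proxRegular : ∀ x ∈ dom g, ProxRegularAt g x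
  proxBounded : ProxBounded g
  threshold : ((1 / L : ℝ) : EReal) ≤ proxThreshold g

/-- The real parameters of the algorithm. -/
structure Params where
  β : ℝ
  α : ℝ
  γbar : ℝ
  τ : ℝ
  ϱ : ℝ
  ςlo : ℝ
  ςhi : ℝ
  σlo : ℝ
  σhi : ℝ

/-- Admissible parameters. -/
structure Params.Admissible (p : Params) (L : ℝ) : Prop where
  β_pos : 0 < p.β
  β_lt : p.β < 1
  α_pos : 0 < p.α
  γbar_ge : 1 / (L + p.α) ≤ p.γbar
  τ_pos : 0 < p.τ
  τ_lt : p.τ < 1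
  ϱ_pos : 0 < p.ϱ
  ϱ_lt : p.ϱ < 1 - p.τ
  ςlo_pos : 0 < p.ςlo
  ςlo_lt : p.ςlo < p.ςhi
  σlo_pos : 0 < p.σlo
  σlo_lt : p.σlo < p.σhi

/-- `L̃⁻¹ = (L + 2α)⁻¹`. -/
def Params.γstar (p : Params) (L : ℝ) : ℝ := (L + 2 * p.α)⁻¹

/-- All quantities produced along a run of the algorithm. -/
structure Iterates (n : ℕ) where
  x : ℕ → E n
  y : ℕ → E n
  d : ℕ → E n
  γ : ℕ → ℝ
  m : ℕ → ℕ
  H : ℕ → (E n →L[ℝ] E n)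
  σ : ℕ → ℝ
  ς : ℕ → ℝ
  l : ℕ → ℕ

/-- `γ̃_k = L̃⁻¹ β^{m_k}`. -/
def Iterates.γt (it : Iterates n) (p : Params) (L : ℝ) (k : ℕ) : ℝ := p.γstar L * p.β ^ it.m k

/-- `R_{γ̃_k}(x^k)`, a vector since `R_{γ̃_k}` is single-valued around `x^k`. -/
def Iterates.res (it : Iterates n) (f g : E n → EReal) (p : Params) (L : ℝ) (k : ℕ) : E n :=
  val (residual f g (it.γt p L k)) (it.x k)

/-- The quadratic model `d ↦ ½ ⟨d, (H + μσ I) d⟩ + ⟨q, d⟩`. -/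
def quadModel (H : E n →L[ℝ] E n) (μσ : ℝ) (q d : E n) : ℝ :=
  1 / 2 * inner ℝ d (H d + μσ • d) + inner ℝ q d

/-- The trial point `β^l (x^k + d^k) + (1 - β^l) T_{γ̃_k}(x^k)`. -/
def Iterates.trial (it : Iterates n) (f g : E n → EReal) (p : Params) (L : ℝ) (k l : ℕ) : E n :=
  (p.β ^ l) • (it.x k + it.d k) + (1 - p.β ^ l) • val (fbStep f g (it.γt p L k)) (it.x k)

/-- An infinite run of the hybrid proximal-gradient / semismooth Newton method with stopping
tolerance `0` (so `x^k ≠ y^k` for all `k`). The envelope is only defined on `O`, so that a trial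
point can be accepted only if it lies in `O`. -/
structure IsRun (f g : E n → EReal) (O : Set (E n)) (L : ℝ) (p : Params) (it : Iterates n) :
    Prop where
  y_zero : it.y 0 ∈ O
  γ_mem : ∀ k, it.γ k ∈ Set.Icc (1 / (L + p.α)) p.γbar
  x_mem : ∀ k, it.x k ∈ fbStep f g (it.γ k) (it.y k)
  x_descent : ∀ k, objective f g (it.x k) ≤
    fbe f g (it.γ k) (it.y k) - ((p.α / 2 * ‖it.x k - it.y k‖ ^ 2 : ℝ) : EReal)
  not_stop : ∀ k, it.x k ≠ it.y k
  m_least : ∀ k, IsLeast {m : ℕ | LocSingleLip (fbStep f g (p.γstar L * p.β ^ m)) (it.x k)} (it.m k)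
  H_mem : ∀ k, it.H k ∈ genHess f g (it.γt p L k) (it.x k)
  σ_mem : ∀ k, it.σ k ∈ Set.Icc p.σlo p.σhi
  ς_mem : ∀ k, it.ς k ∈ Set.Icc p.ςlo p.ςhi
  d_mem : ∀ k, ‖it.d k‖ ≤ it.ς k * ‖it.res f g p L k‖ ^ p.ϱ
  d_min : ∀ k, ∀ d : E n, ‖d‖ ≤ it.ς k * ‖it.res f g p L k‖ ^ p.ϱ →
    quadModel (it.H k) (‖it.res f g p L k‖ ^ p.τ * it.σ k)
        (Q f (it.γt p L k) (it.x k) (it.res f g p L k)) (it.d k) ≤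
      quadModel (it.H k) (‖it.res f g p L k‖ ^ p.τ * it.σ k)
        (Q f (it.γt p L k) (it.x k) (it.res f g p L k)) d
  l_least : ∀ k, IsLeast {l : ℕ | it.trial f g p L k l ∈ O ∧
    fbe f g (it.γt p L k) (it.trial f g p L k l) ≤
      fbe f g (it.γt p L k) (it.x k) -
        (((it.γt p L k - it.γt p L k ^ 2 * L) / 4 * ‖it.res f g p L k‖ ^ 2 : ℝ) : EReal)} (it.l k)
  y_succ : ∀ k, it.y (k + 1) = it.trial f g p L k (it.l k)

/-- The iterates `x^k` converge to `xs ∈ X*`, a local minimum of `F`; `R_*` is metrically subregular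
at `xs` for `0`; and `F_*` is constant on `X*` near `xs`. -/
structure LocalAssumptions (f g : E n → EReal) (O : Set (E n)) (γs : ℝ) (x : ℕ → E n) (xs : E n) :
    Prop where
  tendsto : Tendsto x atTop (𝓝 xs)
  mem : xs ∈ zeroSet f g γs
  localMin : IsLocalMin (objective f g) xs
  subregular : ∃ ε κ : ℝ, 0 < ε ∧ 0 < κ ∧
    (∀ u ∈ Metric.closedBall xs ε ∩ O, Metric.infEDist u (zeroSet f g γs) ≤
      ENNReal.ofReal κ * Metric.infEDist 0 (residual f g γs u)) ∧
    ∃ ε' : ℝ, 0 < ε' ∧ ε' < ε ∧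
      ∀ u ∈ Metric.closedBall xs ε' ∩ zeroSet f g γs, fbe f g γs u = fbe f g γs xs

/-- (C1): Hölder calmness of `∂²F_*` relative to projections onto `X*`. -/
def CondC1 (f g : E n → EReal) (O : Set (E n)) (γs τ : ℝ) (xs : E n) : Prop :=
  ∃ ε₁ κ₁ ρ₁ : ℝ, 0 < ε₁ ∧ 0 < κ₁ ∧ τ < ρ₁ ∧ ρ₁ ≤ 1 ∧
    ∀ u ∈ Metric.closedBall xs ε₁ ∩ O, ∀ ub ∈ projSet (zeroSet f g γs) u,
      ∀ H ∈ genHess f g γs u, ∃ Hb ∈ genHess f g γs ub, ‖H - Hb‖ ≤ κ₁ * ‖u - ub‖ ^ ρ₁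

/-- (C2): positive semidefiniteness of `∂²F_*` on `X*` near `xs`. -/
def CondC2 (f g : E n → EReal) (γs : ℝ) (xs : E n) : Prop :=
  ∃ δ : ℝ, 0 < δ ∧ ∀ u ∈ zeroSet f g γs ∩ Metric.closedBall xs δ, ∀ H ∈ genHess f g γs u,
    ∀ v : E n, 0 ≤ inner ℝ v (H v)

/-- (C3): uniform semismoothness of `R_*` of order `ρ₂` near `xs`. The Clarke Jacobian is a notion
for locally Lipschitz (single-valued) maps, which is part of the condition. -/
def CondC3 (f g : E n → EReal) (O : Set (E n)) (γs τ : ℝ) (xs : E n) : Prop :=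
  ∃ ε₂ κ₂ ρ₂ : ℝ, 0 < ε₂ ∧ 0 < κ₂ ∧ τ ≤ ρ₂ ∧ ρ₂ ≤ 1 ∧
    ∀ u ∈ Metric.closedBall xs ε₂ ∩ O, LocSingleLip (residual f g γs) u ∧
      ∀ w ∈ Metric.closedBall xs ε₂ ∩ O, ∀ J ∈ clarke (val (residual f g γs)) u,
        ‖val (residual f g γs) w - val (residual f g γs) u - J (w - u)‖ ≤ κ₂ * ‖w - u‖ ^ (1 + ρ₂)

end Composite

end PGSSN

end

/-!
Write `F_*`, `R_*`, `X*` for the objects with parameter `γ = L̃⁻¹`. The generalized Hessian factors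
as `H = Q ∘ J` with `J` in the Clarke Jacobian of `R_*`, and it is self-adjoint because the proximal
mapping is a gradient. So `d^k` solves a regularized Newton system for `R_*`, provided that it lies
in the interior of the trust region. Near `x*` the regularization `μ_k ~ dist(x^k, X*)^τ` dominates
the negative curvature allowed by (C1) and (C2). Comparing `d^k` with the step to a projection
onto `X*` then gives `‖d^k‖ = O(dist(x^k, X*))`, which is below the radius since `ϱ < 1`. By (C3)
`‖R_*(x^k + d^k)‖ = O(dist(x^k, X*)^{1+τ})`, and the error bound turns this into a bound on the
distance.

Local minimality and constancy of `F_*` on `X*` sandwich the envelope near `x*`: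
`F(x*) + c ‖R_*‖² ≤ F_* ≤ F(x*) + C dist(·, X*)²`. With the error bound this makes the unit step
acceptable, so that `y^{k+1} = x^k + d^k`. The descent condition on `x^k` gives
`(α/2) ‖x^k - y^k‖² ≤ F_*(y^k) - F(x*) ≤ C dist(y^k, X*)²`, hence
`dist(x^k, X*) = O(dist(y^k, X*))`, and the rate passes to `y^k`.
-/

namespace PGSSN

open Metric
open scoped RealInnerProductSpace

section MetricSpace

variable {α : Type*} [PseudoMetricSpace α] {X : Set α} {x₀ : α}

theorem tendsto_infDist_nhds (hx₀ : x₀ ∈ X) : Tendsto (infDist · X) (𝓝 x₀) (𝓝 0) := by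
  simpa only [infDist_zero_of_mem hx₀] using (continuous_infDist_pt X).tendsto x₀

theorem tendsto_const_mul_infDist_rpow_nhds (hx₀ : x₀ ∈ X) (C : ℝ) {q : ℝ} (hq : 0 < q) :
    Tendsto (fun u => C * infDist u X ^ q) (𝓝 x₀) (𝓝 0) := by
  simpa only [Real.zero_rpow hq.ne', mul_zero] using
    ((tendsto_infDist_nhds hx₀).rpow_const (Or.inr hq.le)).const_mul C

theorem eventually_forall_of_dist_le_mul_infDist (hx₀ : x₀ ∈ X) (C : ℝ) {P : α → α → Prop}
    (hP : ∀ᶠ q in 𝓝 (x₀, x₀), P q.1 q.2) :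
    ∀ᶠ u in 𝓝 x₀, ∀ w, dist w u ≤ C * infDist u X → P u w := by
  obtain ⟨ε, hε, hball⟩ := eventually_nhds_iff_ball.1 hP
  have hCX : Tendsto (fun u => C * infDist u X) (𝓝 x₀) (𝓝 0) := by
    simpa only [mul_zero] using (tendsto_infDist_nhds hx₀).const_mul C
  filter_upwards [ball_mem_nhds x₀ (half_pos hε),
    hCX.eventually (eventually_lt_nhds (half_pos hε))] with u hu hCu w hw
  refine hball (u, w) (mem_ball.2 (max_lt ?_ ?_))
  · exact (mem_ball.1 hu).trans (half_lt_self hε)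
  · linarith [dist_triangle w u x₀, mem_ball.1 hu]

end MetricSpace

theorem eventually_segment_subset {V : Type*} [NormedAddCommGroup V] [NormedSpace ℝ V] {s : Set V}
    {x : V} (hs : s ∈ 𝓝 x) : ∀ᶠ q in 𝓝 (x, x), segment ℝ q.1 q.2 ⊆ s := by
  obtain ⟨r, hr, hsub⟩ := Metric.mem_nhds_iff.1 hs
  filter_upwards [prod_mem_nhds (ball_mem_nhds x hr) (ball_mem_nhds x hr)] with q hq
  exact ((convex_ball x r).segment_subset hq.1 hq.2).trans hsub

theorem tendsto_div_of_le_const_mul_rpow {ι : Type*} {l : Filter ι} {a b : ι → ℝ} {c τ : ℝ}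
    (hτ : 0 < τ) (ha : ∀ᶠ i in l, 0 ≤ a i) (hb : Tendsto b l (𝓝 0)) (hb_pos : ∀ᶠ i in l, 0 < b i)
    (hab : ∀ᶠ i in l, a i ≤ c * b i ^ (1 + τ)) : Tendsto (fun i => a i / b i) l (𝓝 0) := by
  have hlim : Tendsto (fun i => c * b i ^ τ) l (𝓝 0) := by
    simpa only [Real.zero_rpow hτ.ne', mul_zero] using
      (hb.rpow_const (Or.inr hτ.le)).const_mul c
  refine squeeze_zero' ?_ ?_ hlim
  · filter_upwards [ha, hb_pos] with i hai hbi using div_nonneg hai hbi.le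
  · filter_upwards [hb_pos, hab] with i hbi habi
    rw [div_le_iff₀ hbi]
    rw [Real.rpow_add hbi, Real.rpow_one] at habi
    linarith

section InnerProductSpace

variable {V : Type*} [NormedAddCommGroup V] [InnerProductSpace ℝ V]

section Gradient

variable [CompleteSpace V] {ψ : V → ℝ} {G : V → V} {A : V →L[ℝ] V} {x : V}

theorem hasGradientAt_of_eventually_subgradient (hG : ContinuousAt G x)
    (hψ : ∀ᶠ w in 𝓝 x, ψ x + ⟪G x, w - x⟫ ≤ ψ w ∧ ψ w + ⟪G w, x - w⟫ ≤ ψ x) :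
    HasGradientAt ψ (G x) x := by
  rw [hasGradientAt_iff_isLittleO, Asymptotics.isLittleO_iff]
  intro c hc
  filter_upwards [hψ, Metric.continuousAt_iff'.1 hG c hc] with w ⟨hxw, hwx⟩ hGw
  have hdiff : ⟪G w - G x, w - x⟫ ≤ c * ‖w - x‖ :=
    (real_inner_le_norm _ _).trans
      (mul_le_mul_of_nonneg_right (dist_eq_norm (G w) (G x) ▸ hGw.le) (norm_nonneg _))
  rw [inner_sub_left] at hdiff
  rw [← neg_sub w x, inner_neg_right] at hwx
  rw [Real.norm_of_nonneg (by linarith)]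
  linarith

theorem isSelfAdjoint_of_hasFDerivAt_gradient (hψ : ∀ᶠ y in 𝓝 x, HasGradientAt ψ (G y) y)
    (hG : HasFDerivAt G A x) : IsSelfAdjoint A := by
  rw [ContinuousLinearMap.isSelfAdjoint_iff_isSymmetric]
  intro v w
  have hsymm := second_derivative_symmetric_of_eventually (f' := fun y => innerSL ℝ (G y))
    (hψ.mono fun y hy => hy.hasFDerivAt) ((innerSL ℝ).hasFDerivAt.comp x hG) v w
  exact hsymm.trans (real_inner_comm v (A w))

theorem abs_sub_sub_inner_le_of_lipschitz_gradient {L : ℝ} {z : V}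
    (hψ : ∀ y ∈ segment ℝ x z, HasGradientAt ψ (G y) y)
    (hL : ∀ y ∈ segment ℝ x z, ‖G y - G x‖ ≤ L * ‖y - x‖) :
    |ψ z - ψ x - ⟪G x, z - x⟫| ≤ L / 2 * ‖z - x‖ ^ 2 := by
  let c : ℝ → V := fun t => x + t • (z - x)
  have hc : ∀ t, HasDerivAt c (z - x) t := fun t => by
    simpa only [c, one_smul] using ((hasDerivAt_id' t).smul_const (z - x)).const_add x
  have hmem : ∀ t ∈ Set.Icc (0 : ℝ) 1, c t ∈ segment ℝ x z := fun t ht =>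
    segment_eq_image' ℝ x z ▸ Set.mem_image_of_mem _ ht
  have hderiv : ∀ t ∈ Set.Icc (0 : ℝ) 1,
      HasDerivAt (fun t => ψ (c t) - ψ x - t * ⟪G x, z - x⟫) ⟪G (c t) - G x, z - x⟫ t := by
    intro t ht
    have hψc : HasDerivAt (fun t => ψ (c t)) ⟪G (c t), z - x⟫ t :=
      (hψ _ (hmem t ht)).hasFDerivAt.comp_hasDerivAt t (hc t)
    exact ((hψc.sub_const (ψ x)).sub ((hasDerivAt_id' t).mul_const ⟪G x, z - x⟫)).congr_deriv
      (by rw [inner_sub_left, one_mul])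
  have hbound : ∀ t ∈ Set.Icc (0 : ℝ) 1, ‖⟪G (c t) - G x, z - x⟫‖ ≤ L * ‖z - x‖ ^ 2 * t := by
    intro t ht
    have hGt := hL _ (hmem t ht)
    rw [add_sub_cancel_left, norm_smul, Real.norm_of_nonneg ht.1] at hGt
    calc ‖⟪G (c t) - G x, z - x⟫‖ ≤ ‖G (c t) - G x‖ * ‖z - x‖ := norm_inner_le_norm _ _
      _ ≤ L * (t * ‖z - x‖) * ‖z - x‖ := by gcongr
      _ = L * ‖z - x‖ ^ 2 * t := by ring
  have hB : ∀ t : ℝ, HasDerivAt (fun t => L * ‖z - x‖ ^ 2 * (t ^ 2 / 2)) (L * ‖z - x‖ ^ 2 * t) t :=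
    fun t => ((((hasDerivAt_id t).pow 2).div_const 2).const_mul _).congr_deriv (by simp)
  have hfinal := image_norm_le_of_norm_deriv_right_le_deriv_boundary
    (fun t ht => (hderiv t ht).continuousAt.continuousWithinAt)
    (fun t ht => (hderiv t (Set.Ico_subset_Icc_self ht)).hasDerivWithinAt) (by simp [c]) hB
    (fun t ht => hbound t (Set.Ico_subset_Icc_self ht)) (Set.right_mem_Icc.2 zero_le_one)
  simp only [c, one_smul, add_sub_cancel, one_mul, Real.norm_eq_abs] at hfinal
  linarith

end Gradient

section SelfAdjoint

variable [CompleteSpace V] {A W : V →L[ℝ] V}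

theorem isClosed_isSelfAdjoint : IsClosed {A : V →L[ℝ] V | IsSelfAdjoint A} :=
  isClosed_eq continuous_star continuous_id

theorem convex_isSelfAdjoint : Convex ℝ {A : V →L[ℝ] V | IsSelfAdjoint A} :=
  (selfAdjoint.submodule ℝ (V →L[ℝ] V)).convex

theorem isSelfAdjoint_id_sub_smul (a : ℝ) (hA : IsSelfAdjoint A) :
    IsSelfAdjoint (.id ℝ V - a • A) :=
  (IsSelfAdjoint.one (V →L[ℝ] V)).sub ((IsSelfAdjoint.all a).smul hA)

theorem isSymmetric_add_smul_id (a : ℝ) (hA : IsSelfAdjoint A) : (A + a • .id ℝ V).IsSymmetric :=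
  ContinuousLinearMap.isSelfAdjoint_iff_isSymmetric.1
    (hA.add ((IsSelfAdjoint.all a).smul (IsSelfAdjoint.one (V →L[ℝ] V))))

theorem isSelfAdjoint_smul_comp_id_sub_comp (a : ℝ) (hA : IsSelfAdjoint A) (hW : IsSelfAdjoint W) :
    IsSelfAdjoint (a • (A ∘L (.id ℝ V - W ∘L A))) := by
  have heq : A ∘L (.id ℝ V - W ∘L A) = A - A * W * A := by
    rw [ContinuousLinearMap.comp_sub, ContinuousLinearMap.comp_id, mul_assoc]
    rfl
  rw [heq]
  exact (IsSelfAdjoint.all a).smul (hA.sub (hW.conjugate_self hA))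

end SelfAdjoint

section Quadratic

variable {A : V →L[ℝ] V} {q d v : V}

theorem quadratic_sub_eq (hA : A.IsSymmetric) :
    1 / 2 * ⟪d, A d⟫ + ⟪q, d⟫ - (1 / 2 * ⟪v, A v⟫ + ⟪q, v⟫) =
      ⟪A v + q, d - v⟫ + 1 / 2 * ⟪d - v, A (d - v)⟫ := by
  have hdv : ⟪A v, d⟫ = ⟪v, A d⟫ := hA v d
  have hvd : ⟪d, A v⟫ = ⟪v, A d⟫ := by rw [real_inner_comm, hdv]
  simp only [map_sub, inner_add_left, inner_sub_left, inner_sub_right, hdv, hvd,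
    real_inner_comm v (A v)]
  ring

theorem norm_sub_le_of_quadratic_le {c : ℝ} (hc : 0 < c) (hA : A.IsSymmetric)
    (hcoer : ∀ w, c * ‖w‖ ^ 2 ≤ ⟪w, A w⟫)
    (hle : 1 / 2 * ⟪d, A d⟫ + ⟪q, d⟫ ≤ 1 / 2 * ⟪v, A v⟫ + ⟪q, v⟫) :
    ‖d - v‖ ≤ 2 / c * ‖A v + q‖ := by
  have hexp := quadratic_sub_eq (d := d) (v := v) (q := q) hA
  have hlin := neg_le_of_abs_le (abs_real_inner_le_norm (A v + q) (d - v))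
  have hquad := hcoer (d - v)
  rw [div_mul_eq_mul_div, le_div_iff₀ hc]
  rcases (norm_nonneg (d - v)).eq_or_lt with h0 | hpos
  · rw [← h0, zero_mul]; positivity
  · refine le_of_mul_le_mul_right ?_ hpos
    linarith

theorem eq_zero_of_isLocalMin_quadratic (hA : A.IsSymmetric)
    (hmin : IsLocalMin (fun w => 1 / 2 * ⟪w, A w⟫ + ⟪q, w⟫) d) : A d + q = 0 := by
  simp_rw [real_inner_comm (A _)] at hmin
  have hzero := DFunLike.congr_fun (hmin.hasFDerivAt_eq_zero
    (((hA.hasStrictFDerivAt_reApplyInnerSelf d).hasFDerivAt.const_mul (1 / 2)).add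
      (innerSL ℝ q).hasFDerivAt)) (A d + q)
  simpa [← inner_add_left] using hzero

end Quadratic

end InnerProductSpace

variable {n : ℕ}

section SingleValued

variable {S : E n → Set (E n)} {x z : E n}

theorem val_mem (h : ∃! z, z ∈ S x) : val S x ∈ S x := by
  have hne : (S x).Nonempty := h.exists
  rw [val, dif_pos hne]
  exact hne.some_mem

theorem val_eq_of_mem (h : ∃! z, z ∈ S x) (hz : z ∈ S x) : val S x = z :=
  h.unique (val_mem h) hz

theorem eq_singleton_val (h : ∃! z, z ∈ S x) : S x = {val S x} :=
  Set.eq_singleton_iff_unique_mem.2 ⟨val_mem h, fun _ hz => (val_eq_of_mem h hz).symm⟩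

namespace LocSingleLip

theorem eventually_existsUnique (h : LocSingleLip S x) : ∀ᶠ u in 𝓝 x, ∃! z, z ∈ S u := by
  obtain ⟨r, -, hr, huniq, -⟩ := h
  filter_upwards [ball_mem_nhds x hr] using huniq

theorem existsUnique (h : LocSingleLip S x) : ∃! z, z ∈ S x :=
  h.eventually_existsUnique.self_of_nhds

theorem eventually (h : LocSingleLip S x) : ∀ᶠ u in 𝓝 x, LocSingleLip S u := by
  obtain ⟨r, K, hr, huniq, hlip⟩ := h
  filter_upwards [ball_mem_nhds x hr] with u hu
  obtain ⟨s, hs, hsub⟩ := Metric.mem_nhds_iff.1 (isOpen_ball.mem_nhds hu)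
  exact ⟨s, K, hs, fun v hv => huniq v (hsub hv), fun v hv w hw => hlip v (hsub hv) w (hsub hw)⟩

theorem exists_lipschitzOnWith (h : LocSingleLip S x) :
    ∃ K, ∃ s ∈ 𝓝 x, LipschitzOnWith K (val S) s := by
  obtain ⟨r, K, hr, huniq, hlip⟩ := h
  refine ⟨K.toNNReal, ball x r, ball_mem_nhds x hr,
    LipschitzOnWith.of_dist_le' (K := K) fun u hu v hv => ?_⟩
  simpa only [dist_eq_norm] using
    hlip u hu v hv _ (val_mem (huniq u hu)) _ (val_mem (huniq v hv))

theorem continuousAt (h : LocSingleLip S x) : ContinuousAt (val S) x := by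
  obtain ⟨K, s, hs, hK⟩ := h.exists_lipschitzOnWith
  exact hK.continuousOn.continuousAt hs

end LocSingleLip

end SingleValued

section ClarkeJacobian

variable {P R : E n → E n} {V W : E n →L[ℝ] E n} {x : E n}

theorem mem_bSubdiff_iff_frequently :
    V ∈ bSubdiff P x ↔ ∃ᶠ q in 𝓝 (x, V), HasFDerivAt P q.2 q.1 := by
  refine Iff.trans ?_ (mem_closure_iff_frequently
    (s := {q : E n × (E n →L[ℝ] E n) | HasFDerivAt P q.2 q.1}))
  rw [mem_closure_iff_seq_limit]
  constructor
  · rintro ⟨u, D, hu, hD, hDV⟩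
    exact ⟨fun j => (u j, D j), hD, hu.prodMk_nhds hDV⟩
  · rintro ⟨q, hq, hlim⟩
    exact ⟨fun j => (q j).1, fun j => (q j).2, (continuous_fst.tendsto _).comp hlim, hq,
      (continuous_snd.tendsto _).comp hlim⟩

theorem clarke_subset_of_isClosed_of_convex {C : Set (E n →L[ℝ] E n)} (hC : IsClosed C)
    (hC' : Convex ℝ C) (hP : ∀ᶠ u in 𝓝 x, ∀ D, HasFDerivAt P D u → D ∈ C) : clarke P x ⊆ C := by
  refine convexHull_min (fun V hV => ?_) hC'
  have hfreq := (mem_bSubdiff_iff_frequently.1 hV).and_eventually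
    ((continuous_fst.tendsto (x, V)).eventually hP)
  exact hC.mem_of_frequently_of_tendsto (hfreq.mono fun q hq => hq.2 _ hq.1)
    (continuous_snd.tendsto (x, V))

theorem bSubdiff_congr (h : P =ᶠ[𝓝 x] R) : bSubdiff P x = bSubdiff R x := by
  ext V
  have hev : ∀ᶠ q in 𝓝 (x, V), P =ᶠ[𝓝 q.1] R :=
    (continuous_fst.tendsto (x, V)).eventually h.eventuallyEq_nhds
  simp only [mem_bSubdiff_iff_frequently]
  exact frequently_congr (hev.mono fun q hq => hq.hasFDerivAt_iff)

theorem clarke_congr (h : P =ᶠ[𝓝 x] R) : clarke P x = clarke R x := by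
  rw [clarke, bSubdiff_congr h, clarke]

theorem smul_id_sub_mem_clarke (a : ℝ) (hW : W ∈ clarke P x) :
    a • (.id ℝ (E n) - W) ∈ clarke (fun y => a • (y - P y)) x := by
  let Φ : (E n →L[ℝ] E n) →ᵃ[ℝ] (E n →L[ℝ] E n) :=
    a • (AffineMap.const ℝ (E n →L[ℝ] E n) (.id ℝ (E n)) - AffineMap.id ℝ (E n →L[ℝ] E n))
  have hΦ : Φ '' bSubdiff P x ⊆ bSubdiff (fun y => a • (y - P y)) x := by
    rintro _ ⟨V, hV, rfl⟩
    rw [mem_bSubdiff_iff_frequently] at hV ⊢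
    have hlim : Tendsto (fun q : E n × (E n →L[ℝ] E n) => (q.1, Φ q.2)) (𝓝 (x, V)) (𝓝 (x, Φ V)) :=
      Continuous.tendsto (f := fun q : E n × (E n →L[ℝ] E n) =>
        (q.1, a • (ContinuousLinearMap.id ℝ (E n) - q.2))) (by fun_prop) (x, V)
    exact hlim.frequently (hV.mono fun q hq => ((hasFDerivAt_id q.1).sub hq).const_smul a)
  exact convexHull_mono hΦ (Φ.image_convexHull _ ▸ Set.mem_image_of_mem Φ hW)

theorem comp_mem_bSubdiff_comp {φ : E n → E n} {φ' : E n → E n →L[ℝ] E n}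
    (hφ : ∀ᶠ u in 𝓝 x, HasFDerivAt φ (φ' u) u) (hφ' : ContinuousAt φ' x) (hunit : IsUnit (φ' x))
    (hV : V ∈ bSubdiff P (φ x)) : V ∘L φ' x ∈ bSubdiff (P ∘ φ) x := by
  obtain ⟨e, he⟩ := hunit
  have hstrict : HasStrictFDerivAt φ (ContinuousLinearEquiv.ofUnit e : E n →L[ℝ] E n) x := by
    have := hasStrictFDerivAt_of_hasFDerivAt_of_continuousAt hφ hφ'
    rwa [← he] at this
  set φinv := hstrict.localInverse
  have hφinv : Tendsto φinv (𝓝 (φ x)) (𝓝 x) := hstrict.localInverse_tendsto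
  have hfst : Tendsto Prod.fst (𝓝 (φ x, V)) (𝓝 (φ x)) := continuous_fst.tendsto _
  have hlim : Tendsto (fun q : E n × (E n →L[ℝ] E n) => (φinv q.1, q.2 ∘L φ' (φinv q.1)))
      (𝓝 (φ x, V)) (𝓝 (x, V ∘L φ' x)) :=
    (hφinv.comp hfst).prodMk_nhds ((isBoundedBilinearMap_comp.continuous.tendsto (V, φ' x)).comp
      ((continuous_snd.tendsto _).prodMk_nhds (hφ'.tendsto.comp (hφinv.comp hfst))))
  rw [mem_bSubdiff_iff_frequently] at hV ⊢
  refine hlim.frequently ((hV.and_eventually ((hfst.eventually hstrict.eventually_right_inverse).and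
    (hfst.eventually (hφinv.eventually hφ)))).mono ?_)
  rintro ⟨u, D⟩ ⟨hD, hu, hφu⟩
  exact HasFDerivAt.comp (φinv u) (by rwa [show φ (φinv u) = u from hu]) hφu

theorem comp_mem_clarke_comp {φ : E n → E n} {φ' : E n → E n →L[ℝ] E n}
    (hφ : ∀ᶠ u in 𝓝 x, HasFDerivAt φ (φ' u) u) (hφ' : ContinuousAt φ' x) (hunit : IsUnit (φ' x))
    (hW : W ∈ clarke P (φ x)) : W ∘L φ' x ∈ clarke (P ∘ φ) x := by
  let precomp : (E n →L[ℝ] E n) →ₗ[ℝ] (E n →L[ℝ] E n) :=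
    (ContinuousLinearMap.precomp (E n) (φ' x)).toLinearMap
  have hsub : precomp '' bSubdiff P (φ x) ⊆ bSubdiff (P ∘ φ) x := by
    rintro _ ⟨V, hV, rfl⟩
    exact comp_mem_bSubdiff_comp hφ hφ' hunit hV
  exact convexHull_mono hsub (precomp.image_convexHull _ ▸ Set.mem_image_of_mem precomp hW)

end ClarkeJacobian

section ForwardBackward

variable {f g : E n → EReal} {γ : ℝ} {x : E n}

theorem residual_existsUnique (h : ∃! z, z ∈ fbStep f g γ x) : ∃! r, r ∈ residual f g γ x := by
  obtain ⟨z, hz, huniq⟩ := h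
  refine ⟨_, Set.mem_image_of_mem _ hz, ?_⟩
  rintro _ ⟨w, hw, rfl⟩
  rw [huniq w hw]

theorem val_residual (h : ∃! z, z ∈ fbStep f g γ x) :
    val (residual f g γ) x = γ⁻¹ • (x - val (fbStep f g γ) x) :=
  val_eq_of_mem (residual_existsUnique h) (Set.mem_image_of_mem _ (val_mem h))

theorem LocSingleLip.fbStep_of_residual (hγ : 0 < γ) (h : LocSingleLip (residual f g γ) x) :
    LocSingleLip (fbStep f g γ) x := by
  obtain ⟨r, K, hr, huniq, hlip⟩ := h
  have hmem : ∀ {u z}, z ∈ fbStep f g γ u → γ⁻¹ • (u - z) ∈ residual f g γ u := fun hz =>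
    Set.mem_image_of_mem _ hz
  have hz_eq : ∀ u z : E n, z = u - γ • γ⁻¹ • (u - z) := fun u z => by
    rw [smul_inv_smul₀ hγ.ne', sub_sub_cancel]
  refine ⟨r, 1 + γ * K, hr, fun u hu => ?_, fun u hu v hv z hz w hw => ?_⟩
  · obtain ⟨_, ⟨z, hz, rfl⟩, -⟩ := huniq u hu
    refine ⟨z, hz, fun w hw => ?_⟩
    rw [hz_eq u w, (huniq u hu).unique (hmem hw) (hmem hz), ← hz_eq]
  · calc ‖z - w‖ = ‖(u - v) - γ • (γ⁻¹ • (u - z) - γ⁻¹ • (v - w))‖ := by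
          rw [smul_sub, sub_sub_sub_comm, ← hz_eq, ← hz_eq]
      _ ≤ ‖u - v‖ + γ * ‖γ⁻¹ • (u - z) - γ⁻¹ • (v - w)‖ := by
          simpa only [norm_smul, Real.norm_of_nonneg hγ.le] using norm_sub_le (u - v) (γ • _)
      _ ≤ ‖u - v‖ + γ * (K * ‖u - v‖) := by
          gcongr
          exact hlip u hu v hv _ (hmem hz) _ (hmem hw)
      _ = (1 + γ * K) * ‖u - v‖ := by ring

theorem mem_zeroSet_iff (hγ : γ ≠ 0) : x ∈ zeroSet f g γ ↔ x ∈ fbStep f g γ x := by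
  constructor
  · rintro ⟨z, hz, hzx : γ⁻¹ • (x - z) = 0⟩
    rwa [← sub_eq_zero.1 ((smul_eq_zero.1 hzx).resolve_left (inv_ne_zero hγ))] at hz
  · exact fun h => ⟨x, h, by simp only [sub_self, smul_zero]⟩

end ForwardBackward

namespace BasicAssumptions

variable {f g : E n → EReal} {O : Set (E n)} {L γ : ℝ} {x : E n}

theorem hasGradientAt (h : BasicAssumptions f g O L) (hx : x ∈ O) :
    HasGradientAt (fun u => (f u).toReal) (grad f x) x :=
  (h.f_diff x hx).hasGradientAt

theorem coe_toReal (h : BasicAssumptions f g O L) (hx : x ∈ O) : ((f x).toReal : EReal) = f x :=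
  EReal.coe_toReal (h.f_ne_top x hx) (h.f_ne_bot x)

theorem isSelfAdjoint_hess (h : BasicAssumptions f g O L) (hx : x ∈ O) :
    IsSelfAdjoint (hess f x) :=
  isSelfAdjoint_of_hasFDerivAt_gradient
    ((h.isOpen.eventually_mem hx).mono fun _ hy => h.hasGradientAt hy)
    (h.grad_diff x hx).hasFDerivAt

theorem norm_hess_le (h : BasicAssumptions f g O L) (hx : x ∈ O) : ‖hess f x‖ ≤ L :=
  norm_fderiv_le_of_lip' ℝ h.L_pos.le
    ((h.isOpen.eventually_mem hx).mono fun y hy => h.grad_lip y hy x hx)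

theorem continuousAt_hess (h : BasicAssumptions f g O L) (hx : x ∈ O) :
    ContinuousAt (hess f) x := by
  obtain ⟨K, hK⟩ := h.hess_lip
  have hlip : LipschitzOnWith K.toNNReal (hess f) O :=
    LipschitzOnWith.of_dist_le' fun u hu v hv => by
      simpa only [dist_eq_norm] using hK u hu v hv
  exact hlip.continuousOn.continuousAt (h.isOpen.mem_nhds hx)

theorem isSelfAdjoint_Q (h : BasicAssumptions f g O L) (hx : x ∈ O) : IsSelfAdjoint (Q f γ x) :=
  isSelfAdjoint_id_sub_smul γ (h.isSelfAdjoint_hess hx)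

theorem continuousAt_Q (h : BasicAssumptions f g O L) (hx : x ∈ O) : ContinuousAt (Q f γ) x :=
  continuousAt_const.sub ((h.continuousAt_hess hx).const_smul γ)

theorem norm_smul_hess_apply_le (h : BasicAssumptions f g O L) (hγ : 0 ≤ γ) (hx : x ∈ O)
    (w : E n) : ‖γ • hess f x w‖ ≤ γ * L * ‖w‖ := by
  rw [norm_smul, Real.norm_of_nonneg hγ, mul_assoc]
  gcongr
  exact (hess f x).le_of_opNorm_le (h.norm_hess_le hx) w

theorem norm_Q_apply_le (h : BasicAssumptions f g O L) (hγ : 0 ≤ γ) (hx : x ∈ O) (w : E n) :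
    ‖Q f γ x w‖ ≤ (1 + γ * L) * ‖w‖ := by
  have hsub : ‖Q f γ x w‖ ≤ ‖w‖ + ‖γ • hess f x w‖ := norm_sub_le _ _
  linarith [h.norm_smul_hess_apply_le hγ hx w]

theorem le_norm_Q_apply (h : BasicAssumptions f g O L) (hγ : 0 ≤ γ) (hx : x ∈ O) (w : E n) :
    (1 - γ * L) * ‖w‖ ≤ ‖Q f γ x w‖ := by
  have hsub : ‖w‖ - ‖γ • hess f x w‖ ≤ ‖Q f γ x w‖ := norm_sub_norm_le _ _
  linarith [h.norm_smul_hess_apply_le hγ hx w]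

theorem hasFDerivAt_gradientStep (h : BasicAssumptions f g O L) (hx : x ∈ O) :
    HasFDerivAt (fun u => u - γ • grad f u) (Q f γ x) x :=
  (hasFDerivAt_id x).sub ((h.grad_diff x hx).hasFDerivAt.const_smul γ)

end BasicAssumptions

section Prox

variable {f g : E n → EReal} {O : Set (E n)} {L γ : ℝ} {u v x z : E n} {H W : E n →L[ℝ] E n}

theorem ne_top_of_mem_prox (hg : Proper g) (hz : z ∈ prox γ g u) : g z ≠ ⊤ := by
  obtain ⟨w, hw⟩ := hg.2
  intro htop
  have hle := hz w
  rw [proxObj, htop, EReal.coe_add_top, top_le_iff] at hle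
  exact (EReal.add_lt_top (EReal.coe_ne_top _) hw).ne hle

theorem BasicAssumptions.mem_of_mem_fbStep (h : BasicAssumptions f g O L)
    (hz : z ∈ fbStep f g γ x) : z ∈ O :=
  h.dom_subset (lt_top_iff_ne_top.2 (ne_top_of_mem_prox h.g_proper hz))

theorem proxObj_eq_coe (hg : Proper g) (hz : g z ≠ ⊤) :
    proxObj γ g u z = (((2 * γ)⁻¹ * ‖z - u‖ ^ 2 + (g z).toReal : ℝ) : EReal) := by
  rw [proxObj, EReal.coe_add, EReal.coe_toReal hz (hg.1 z)]

/-- The conjugate potential `w ↦ sup_z {⟪z, w⟫ - ½ ‖z‖² - γ g z}` of the proximal mapping, which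
equals `½ ‖w‖²` minus `γ` times the Moreau envelope; the supremum is attained at `val (prox γ g) w`
wherever `prox γ g` is single-valued, and it is only used there. -/
noncomputable def proxPotential (γ : ℝ) (g : E n → EReal) (w : E n) : ℝ :=
  ⟪val (prox γ g) w, w⟫ - 1 / 2 * ‖val (prox γ g) w‖ ^ 2 - γ * (g (val (prox γ g) w)).toReal

theorem proxPotential_add_inner_le (hg : Proper g) (hγ : 0 < γ) (hu : ∃! z, z ∈ prox γ g u)
    (hv : ∃! z, z ∈ prox γ g v) :
    proxPotential γ g u + ⟪val (prox γ g) u, v - u⟫ ≤ proxPotential γ g v := by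
  have hmin := val_mem hv (val (prox γ g) u)
  rw [proxObj_eq_coe hg (ne_top_of_mem_prox hg (val_mem hu)),
    proxObj_eq_coe hg (ne_top_of_mem_prox hg (val_mem hv)), EReal.coe_le_coe_iff,
    norm_sub_sq_real, norm_sub_sq_real] at hmin
  have hscale : ∀ a b : ℝ, (2 * γ)⁻¹ * a + b = γ⁻¹ * (1 / 2 * a + γ * b) := fun a b => by
    field_simp
  rw [hscale, hscale, mul_le_mul_iff_right₀ (inv_pos.2 hγ)] at hmin
  rw [proxPotential, proxPotential, inner_sub_right]
  linarith

theorem hasGradientAt_proxPotential (hg : Proper g) (hγ : 0 < γ) (h : LocSingleLip (prox γ g) u) :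
    HasGradientAt (proxPotential γ g) (val (prox γ g) u) u :=
  hasGradientAt_of_eventually_subgradient h.continuousAt <|
    h.eventually_existsUnique.mono fun _ hw =>
      ⟨proxPotential_add_inner_le hg hγ h.existsUnique hw,
        proxPotential_add_inner_le hg hγ hw h.existsUnique⟩

theorem isSelfAdjoint_of_mem_clarke_prox (hg : Proper g) (hγ : 0 < γ)
    (h : LocSingleLip (prox γ g) u) (hW : W ∈ clarke (val (prox γ g)) u) : IsSelfAdjoint W := by
  refine clarke_subset_of_isClosed_of_convex isClosed_isSelfAdjoint convex_isSelfAdjoint ?_ hW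
  filter_upwards [h.eventually] with w hw D hD
  exact isSelfAdjoint_of_hasFDerivAt_gradient
    (hw.eventually.mono fun _ hy => hasGradientAt_proxPotential hg hγ hy) hD

theorem isSelfAdjoint_of_mem_genHess (h : BasicAssumptions f g O L) (hγ : 0 < γ) (hx : x ∈ O)
    (hH : H ∈ genHess f g γ x) : IsSelfAdjoint H := by
  obtain ⟨hprox, -, W, hW, rfl⟩ := hH
  exact isSelfAdjoint_smul_comp_id_sub_comp γ⁻¹ (h.isSelfAdjoint_Q hx)
    (isSelfAdjoint_of_mem_clarke_prox h.g_proper hγ hprox hW)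

theorem exists_mem_clarke_residual_of_mem_genHess (h : BasicAssumptions f g O L) (hx : x ∈ O)
    (hH : H ∈ genHess f g γ x) : ∃ J ∈ clarke (val (residual f g γ)) x, H = Q f γ x ∘L J := by
  obtain ⟨hprox, hunit, W, hW, rfl⟩ := hH
  have hstep : ∀ᶠ y in 𝓝 x, HasFDerivAt (fun u => u - γ • grad f u) (Q f γ y) y :=
    (h.isOpen.eventually_mem hx).mono fun y hy => h.hasFDerivAt_gradientStep hy
  have hres : val (residual f g γ) =ᶠ[𝓝 x]
      fun y => γ⁻¹ • (y - val (prox γ g) (y - γ • grad f y)) :=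
    ((h.hasFDerivAt_gradientStep hx).continuousAt.eventually hprox.eventually_existsUnique).mono
      fun y hy => val_residual hy
  have hmem : γ⁻¹ • (.id ℝ (E n) - W ∘L Q f γ x) ∈ clarke (val (residual f g γ)) x := by
    have hcomp := comp_mem_clarke_comp hstep (h.continuousAt_Q hx) hunit hW
    have hsmul := smul_id_sub_mem_clarke γ⁻¹ hcomp
    rw [clarke_congr hres]
    exact hsmul
  refine ⟨_, hmem, ?_⟩
  rw [ContinuousLinearMap.comp_smul]

end Prox

section Envelope

variable {f g : E n → EReal} {O : Set (E n)} {L γ : ℝ} {x z : E n}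

-- Completing the square: the model minimized in `F_γ(x)` is a constant plus the proximal objective
-- at the gradient step.
theorem fbe_model_eq (hγ : 0 < γ) (w : E n) :
    (((f x).toReal + ⟪grad f x, w - x⟫ + (2 * γ)⁻¹ * ‖w - x‖ ^ 2 : ℝ) : EReal) + g w =
      (((f x).toReal - γ / 2 * ‖grad f x‖ ^ 2 : ℝ) : EReal) +
        proxObj γ g (x - γ • grad f x) w := by
  rw [proxObj, ← add_assoc, ← EReal.coe_add, ← sub_add, norm_add_sq_real, norm_smul,
    Real.norm_of_nonneg hγ.le, real_inner_smul_right, real_inner_comm]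
  congr 2
  field_simp
  ring

theorem fbe_eq_of_mem_fbStep (hγ : 0 < γ) (hz : z ∈ fbStep f g γ x) :
    fbe f g γ x =
      (((f x).toReal + ⟪grad f x, z - x⟫ + (2 * γ)⁻¹ * ‖z - x‖ ^ 2 : ℝ) : EReal) + g z := by
  refine le_antisymm (iInf_le _ z) (le_iInf fun w => ?_)
  rw [fbe_model_eq hγ, fbe_model_eq hγ]
  exact add_le_add_right (hz w) _

theorem fbe_antitone {γ' : ℝ} (hγ : 0 < γ) (hγ' : γ ≤ γ') (x : E n) :
    fbe f g γ' x ≤ fbe f g γ x := by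
  refine iInf_mono fun z => add_le_add_left (EReal.coe_le_coe_iff.2 ?_) _
  gcongr

namespace BasicAssumptions

theorem fbe_eq_objective (h : BasicAssumptions f g O L) (hγ : 0 < γ) (hx : x ∈ zeroSet f g γ) :
    fbe f g γ x = objective f g x := by
  rw [mem_zeroSet_iff hγ.ne'] at hx
  rw [fbe_eq_of_mem_fbStep hγ hx, objective, ← h.coe_toReal (h.mem_of_mem_fbStep hx)]
  simp only [EReal.toReal_coe, sub_self, inner_zero_right, norm_zero, ne_eq,
    OfNat.ofNat_ne_zero, not_false_eq_true, zero_pow, mul_zero, add_zero]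

theorem abs_f_sub_sub_inner_le (h : BasicAssumptions f g O L) (hxz : segment ℝ x z ⊆ O) :
    |(f z).toReal - (f x).toReal - ⟪grad f x, z - x⟫| ≤ L / 2 * ‖z - x‖ ^ 2 :=
  abs_sub_sub_inner_le_of_lipschitz_gradient (fun _ hy => h.hasGradientAt (hxz hy))
    fun y hy => h.grad_lip y (hxz hy) x (hxz (left_mem_segment ℝ x z))

theorem fbe_le_objective_add (h : BasicAssumptions f g O L) (hxz : segment ℝ x z ⊆ O) :
    fbe f g γ x ≤ objective f g z + ((((2 * γ)⁻¹ + L / 2) * ‖z - x‖ ^ 2 : ℝ) : EReal) := by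
  refine (iInf_le _ z).trans ?_
  rw [objective, ← h.coe_toReal (hxz (right_mem_segment ℝ x z)), add_right_comm (_ : EReal) (g z),
    ← EReal.coe_add]
  refine add_le_add_left (EReal.coe_le_coe_iff.2 ?_) _
  linarith [(abs_le.1 (h.abs_f_sub_sub_inner_le hxz)).1]

theorem objective_add_le_fbe (h : BasicAssumptions f g O L) (hγ : 0 < γ)
    (hxz : segment ℝ x z ⊆ O) (hz : z ∈ fbStep f g γ x) :
    objective f g z + ((((2 * γ)⁻¹ - L / 2) * ‖z - x‖ ^ 2 : ℝ) : EReal) ≤ fbe f g γ x := by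
  rw [fbe_eq_of_mem_fbStep hγ hz, objective, ← h.coe_toReal (hxz (right_mem_segment ℝ x z)),
    add_right_comm (_ : EReal) (g z), ← EReal.coe_add]
  refine add_le_add_left (EReal.coe_le_coe_iff.2 ?_) _
  linarith [(abs_le.1 (h.abs_f_sub_sub_inner_le hxz)).2]

end BasicAssumptions

end Envelope

section SolutionSet

variable {f g : E n → EReal} {O : Set (E n)} {L γ κ : ℝ} {u xs : E n}

theorem val_residual_eq_zero (h : LocSingleLip (residual f g γ) u) (hu : u ∈ zeroSet f g γ) :
    val (residual f g γ) u = 0 :=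
  val_eq_of_mem h.existsUnique hu

theorem LocSingleLip.mem_zeroSet_of_mem_closure (h : LocSingleLip (residual f g γ) u)
    (hu : u ∈ closure (zeroSet f g γ)) : u ∈ zeroSet f g γ := by
  have hfreq : ∃ᶠ w in 𝓝 u, val (residual f g γ) w ∈ ({0} : Set (E n)) :=
    (mem_closure_iff_frequently.1 hu).mp
      (h.eventually.mono fun _ hw hwz => val_residual_eq_zero hw hwz)
  have hzero : val (residual f g γ) u = 0 :=
    isClosed_singleton.mem_of_frequently_of_tendsto hfreq h.continuousAt
  have hmem := val_mem h.existsUnique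
  rwa [hzero] at hmem

theorem eventually_forall_mem_projSet {X : Set (E n)} (hxs : xs ∈ X) {P : E n → E n → Prop}
    (hP : ∀ᶠ q in 𝓝 (xs, xs), P q.1 q.2) : ∀ᶠ u in 𝓝 xs, ∀ ub ∈ projSet X u, P u ub :=
  (eventually_forall_of_dist_le_mul_infDist hxs 1 hP).mono fun u hu ub hub =>
    hu ub (by rw [one_mul, dist_comm, dist_eq_norm, hub.2])

theorem eventually_projSet_subset {X s : Set (E n)} (hxs : xs ∈ X) (hs : s ∈ 𝓝 xs) :
    ∀ᶠ u in 𝓝 xs, projSet X u ⊆ s :=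
  eventually_forall_mem_projSet (P := fun _ ub => ub ∈ s) hxs (continuousAt_snd.eventually_mem hs)

theorem LocSingleLip.eventually_projSet_nonempty (h : LocSingleLip (residual f g γ) xs)
    (hxs : xs ∈ zeroSet f g γ) : ∀ᶠ u in 𝓝 xs, (projSet (zeroSet f g γ) u).Nonempty := by
  filter_upwards [eventually_forall_of_dist_le_mul_infDist hxs 1
    (P := fun _ ub => LocSingleLip (residual f g γ) ub)
    (continuousAt_snd.eventually h.eventually)] with u hu
  obtain ⟨ub, hub, hdist⟩ := exists_mem_closure_infDist_eq_dist ⟨xs, hxs⟩ u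
  refine ⟨ub, (hu ub ?_).mem_zeroSet_of_mem_closure hub, by rw [hdist, dist_eq_norm]⟩
  rw [one_mul, dist_comm, hdist]

theorem LocSingleLip.mem_zeroSet_of_infDist_eq_zero (h : LocSingleLip (residual f g γ) u)
    (hne : (zeroSet f g γ).Nonempty) (h0 : infDist u (zeroSet f g γ) = 0) : u ∈ zeroSet f g γ :=
  h.mem_zeroSet_of_mem_closure ((mem_closure_iff_infDist_zero hne).2 h0)

theorem LocSingleLip.exists_norm_val_residual_le (h : LocSingleLip (residual f g γ) xs)
    (hxs : xs ∈ zeroSet f g γ) : ∃ K, 0 ≤ K ∧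
      ∀ᶠ u in 𝓝 xs, ‖val (residual f g γ) u‖ ≤ K * infDist u (zeroSet f g γ) := by
  obtain ⟨K, s, hs, hlip⟩ := h.exists_lipschitzOnWith
  refine ⟨K, K.2, ?_⟩
  filter_upwards [hs, h.eventually_projSet_nonempty hxs,
    eventually_projSet_subset hxs h.eventually, eventually_projSet_subset hxs hs]
    with u hu ⟨ub, hub⟩ hloc hmem
  have hdist := hlip.dist_le_mul u hu ub (hmem hub)
  rwa [val_residual_eq_zero (hloc hub) hub.1, dist_zero_right, dist_eq_norm, hub.2] at hdist

theorem LocalAssumptions.exists_infDist_le {x : ℕ → E n} (h : LocalAssumptions f g O γ x xs)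
    (hO : O ∈ 𝓝 xs) (hR : LocSingleLip (residual f g γ) xs) : ∃ κ, 0 < κ ∧
      ∀ᶠ u in 𝓝 xs, infDist u (zeroSet f g γ) ≤ κ * ‖val (residual f g γ) u‖ := by
  obtain ⟨ε, κ, hε, hκ, hbound, -⟩ := h.subregular
  refine ⟨κ, hκ, ?_⟩
  filter_upwards [closedBall_mem_nhds xs hε, hO, hR.eventually_existsUnique] with u huε huO huR
  have hle := hbound u ⟨huε, huO⟩
  rw [eq_singleton_val huR, infEDist_singleton, edist_zero_left, ← enorm_eq_nnnorm,
    ← ofReal_norm, ← ENNReal.ofReal_mul hκ.le] at hle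
  exact ENNReal.toReal_le_of_le_ofReal (by positivity) hle

theorem LocalAssumptions.eventually_fbe_eq {x : ℕ → E n} (h : LocalAssumptions f g O γ x xs)
    (hb : BasicAssumptions f g O L) (hγ : 0 < γ) :
    ∀ᶠ u in 𝓝 xs, u ∈ zeroSet f g γ → fbe f g γ u = objective f g xs := by
  obtain ⟨-, -, -, -, -, ε, hε, -, hconst⟩ := h.subregular
  filter_upwards [closedBall_mem_nhds xs hε] with u hu huz
  rw [hconst u ⟨hu, huz⟩, hb.fbe_eq_objective hγ h.mem]

theorem BasicAssumptions.exists_objective_eq_coe (h : BasicAssumptions f g O L) (hγ : γ ≠ 0)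
    (hxs : xs ∈ zeroSet f g γ) : ∃ c : ℝ, objective f g xs = c := by
  rw [mem_zeroSet_iff hγ] at hxs
  refine ⟨(f xs).toReal + (g xs).toReal, ?_⟩
  rw [objective, EReal.coe_add, h.coe_toReal (h.mem_of_mem_fbStep hxs),
    EReal.coe_toReal (ne_top_of_mem_prox h.g_proper hxs) (h.g_proper.1 xs)]

theorem eventually_fbe_le (hb : BasicAssumptions f g O L) (hγ : 0 < γ) (hO : O ∈ 𝓝 xs)
    (hR : LocSingleLip (residual f g γ) xs) (hxs : xs ∈ zeroSet f g γ)
    (hconst : ∀ᶠ u in 𝓝 xs, u ∈ zeroSet f g γ → fbe f g γ u = objective f g xs) :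
    ∀ᶠ u in 𝓝 xs, fbe f g γ u ≤ objective f g xs +
      ((((2 * γ)⁻¹ + L / 2) * infDist u (zeroSet f g γ) ^ 2 : ℝ) : EReal) := by
  filter_upwards [hR.eventually_projSet_nonempty hxs,
    eventually_forall_mem_projSet (P := fun u ub => segment ℝ u ub ⊆ O) hxs
      (eventually_segment_subset hO),
    eventually_projSet_subset hxs hconst] with u ⟨ub, hub⟩ hseg heq
  rw [← heq hub hub.1, hb.fbe_eq_objective hγ hub.1, ← hub.2, norm_sub_rev]
  exact hb.fbe_le_objective_add (hseg ub hub)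

theorem eventually_objective_add_le_fbe (hb : BasicAssumptions f g O L) (hγ : 0 < γ)
    (hO : O ∈ 𝓝 xs) (hR : LocSingleLip (residual f g γ) xs) (hxs : xs ∈ zeroSet f g γ)
    (hmin : IsLocalMin (objective f g) xs) :
    ∀ᶠ u in 𝓝 xs, objective f g xs +
      (((γ - γ ^ 2 * L) / 2 * ‖val (residual f g γ) u‖ ^ 2 : ℝ) : EReal) ≤ fbe f g γ u := by
  have hstep : Tendsto (fun u => u - γ • val (residual f g γ) u) (𝓝 xs) (𝓝 xs) := by
    have hlim : Tendsto (fun u => u - γ • val (residual f g γ) u) (𝓝 xs)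
        (𝓝 (xs - γ • val (residual f g γ) xs)) :=
      continuousAt_id.sub (hR.continuousAt.const_smul γ)
    rwa [val_residual_eq_zero hR hxs, smul_zero, sub_zero] at hlim
  filter_upwards [(hR.fbStep_of_residual hγ).eventually_existsUnique, hstep.eventually hmin,
    (Tendsto.prodMk_nhds tendsto_id hstep).eventually (eventually_segment_subset hO)]
    with u hu hle hseg
  have hT : u - γ • val (residual f g γ) u = val (fbStep f g γ) u := by
    rw [val_residual hu, smul_inv_smul₀ hγ.ne', sub_sub_cancel]
  refine le_trans ?_ (hb.objective_add_le_fbe hγ hseg (hT ▸ val_mem hu))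
  refine add_le_add hle (EReal.coe_le_coe_iff.2 (le_of_eq ?_))
  rw [sub_sub_cancel_left, norm_neg, norm_smul, Real.norm_of_nonneg hγ.le]
  field_simp

theorem eventually_mul_infDist_rpow_le_mul_norm_rpow {F : E n → E n} {X : Set (E n)} {q s c : ℝ}
    (hxs : xs ∈ X) (herr : ∀ᶠ u in 𝓝 xs, infDist u X ≤ κ * ‖F u‖) (hκ : 0 ≤ κ) {C : ℝ}
    (hC : 0 ≤ C) (hq : 0 ≤ q) (hqs : q < s) (hc : 0 < c) :
    ∀ᶠ u in 𝓝 xs, C * infDist u X ^ s ≤ c * ‖F u‖ ^ q := by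
  filter_upwards [herr, (tendsto_const_mul_infDist_rpow_nhds hxs (C * κ ^ q)
    (sub_pos.2 hqs)).eventually (eventually_le_nhds hc)] with u hu hsmall
  have hδ : 0 ≤ infDist u X := infDist_nonneg
  calc C * infDist u X ^ s
      = C * infDist u X ^ (s - q) * infDist u X ^ q := by
        rw [mul_assoc, ← Real.rpow_add_of_nonneg hδ (sub_pos.2 hqs).le hq, sub_add_cancel]
    _ ≤ C * infDist u X ^ (s - q) * (κ * ‖F u‖) ^ q := by gcongr
    _ = C * κ ^ q * infDist u X ^ (s - q) * ‖F u‖ ^ q := by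
        rw [Real.mul_rpow hκ (norm_nonneg _)]; ring
    _ ≤ c * ‖F u‖ ^ q := by gcongr

theorem eventually_sufficient_decrease {τ c : ℝ} (hγ : 0 < γ) (hγL : γ * L < 1) (hL : 0 ≤ L)
    (hτ : 0 < τ) (hxs : xs ∈ zeroSet f g γ) (hκ : 0 ≤ κ)
    (herr : ∀ᶠ u in 𝓝 xs, infDist u (zeroSet f g γ) ≤ κ * ‖val (residual f g γ) u‖)
    (hupper : ∀ᶠ u in 𝓝 xs, fbe f g γ u ≤ objective f g xs +
      ((((2 * γ)⁻¹ + L / 2) * infDist u (zeroSet f g γ) ^ 2 : ℝ) : EReal))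
    (hlower : ∀ᶠ u in 𝓝 xs, objective f g xs +
      (((γ - γ ^ 2 * L) / 2 * ‖val (residual f g γ) u‖ ^ 2 : ℝ) : EReal) ≤ fbe f g γ u) :
    ∀ᶠ q in 𝓝 xs ×ˢ 𝓝 xs,
      infDist q.2 (zeroSet f g γ) ≤ c * infDist q.1 (zeroSet f g γ) ^ (1 + τ) →
      fbe f g γ q.2 ≤ fbe f g γ q.1 -
        (((γ - γ ^ 2 * L) / 4 * ‖val (residual f g γ) q.1‖ ^ 2 : ℝ) : EReal) := by
  have hgap : 0 < (γ - γ ^ 2 * L) / 4 := by nlinarith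
  have hsmall := eventually_mul_infDist_rpow_le_mul_norm_rpow hxs herr hκ
    (C := ((2 * γ)⁻¹ + L / 2) * c ^ 2) (q := 2) (s := 2 + 2 * τ) (by positivity) (by norm_num)
    (by linarith) hgap
  filter_upwards [(hsmall.and hlower).prod_mk hupper] with q ⟨⟨hsm, hlo⟩, hup⟩ hle
  have hδ : 0 ≤ infDist q.1 (zeroSet f g γ) := infDist_nonneg
  have hpow : (infDist q.1 (zeroSet f g γ) ^ (1 + τ)) ^ 2 =
      infDist q.1 (zeroSet f g γ) ^ (2 + 2 * τ) := by
    rw [← Real.rpow_mul_natCast hδ]; congr 1; push_cast; ring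
  have hquad : ((2 * γ)⁻¹ + L / 2) * infDist q.2 (zeroSet f g γ) ^ 2 ≤
      (γ - γ ^ 2 * L) / 4 * ‖val (residual f g γ) q.1‖ ^ 2 := by
    calc _ ≤ ((2 * γ)⁻¹ + L / 2) * (c * infDist q.1 (zeroSet f g γ) ^ (1 + τ)) ^ 2 := by
          gcongr; exact infDist_nonneg
      _ = ((2 * γ)⁻¹ + L / 2) * c ^ 2 * infDist q.1 (zeroSet f g γ) ^ (2 + 2 * τ) := by
          rw [mul_pow, hpow, mul_assoc]
      _ ≤ _ := by rwa [Real.rpow_two] at hsm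
  rw [EReal.le_sub_iff_add_le (Or.inl (EReal.coe_ne_bot _)) (Or.inl (EReal.coe_ne_top _))]
  refine (add_le_add_left hup _).trans (le_trans ?_ hlo)
  rw [add_assoc, ← EReal.coe_add]
  exact add_le_add_right (EReal.coe_le_coe_iff.2 (by linarith)) _

end SolutionSet

section NewtonDirection

variable {f g : E n → EReal} {O : Set (E n)} {L γ κ τ : ℝ} {u d xs : E n}

theorem CondC3.locSingleLip_residual (hC3 : CondC3 f g O γ τ xs) (hxs : xs ∈ O) :
    LocSingleLip (residual f g γ) xs := by
  obtain ⟨ε, _, _, hε, -, -, -, h⟩ := hC3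
  exact (h xs ⟨mem_closedBall_self hε.le, hxs⟩).1

/-- The linearization of `H` at `u` by any element of its Clarke Jacobian there predicts `H w` up to
`C ‖w - u‖ ^ p`. Semismoothness of order `p - 1` asks for this bound with `w` fixed and `u` near it;
near `xs` condition (C3) gives it for all pairs. -/
def ClarkeRemainderLE (H : E n → E n) (C p : ℝ) (u w : E n) : Prop :=
  ∀ J ∈ clarke H u, ‖H w - H u - J (w - u)‖ ≤ C * ‖w - u‖ ^ p

theorem CondC3.exists_eventually_clarkeRemainderLE (hC3 : CondC3 f g O γ τ xs) (hO : O ∈ 𝓝 xs)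
    (hτ : 0 ≤ τ) : ∃ κ₂, 0 < κ₂ ∧ ∀ᶠ q in 𝓝 (xs, xs),
      ClarkeRemainderLE (val (residual f g γ)) κ₂ (1 + τ) q.1 q.2 := by
  obtain ⟨ε, κ₂, ρ, hε, hκ₂, hτρ, -, h⟩ := hC3
  have hnear : closedBall xs ε ∩ O ∈ 𝓝 xs := inter_mem (closedBall_mem_nhds xs hε) hO
  have hdist : Tendsto (fun q : E n × E n => ‖q.2 - q.1‖) (𝓝 (xs, xs)) (𝓝 0) := by
    simpa using (continuous_snd.sub continuous_fst).norm.tendsto (xs, xs)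
  refine ⟨κ₂, hκ₂, ?_⟩
  filter_upwards [prod_mem_nhds hnear hnear, hdist.eventually (eventually_le_nhds one_pos)]
    with q hq hq1 J hJ
  refine ((h q.1 hq.1).2 q.2 hq.2 J hJ).trans (mul_le_mul_of_nonneg_left ?_ hκ₂.le)
  exact Real.rpow_le_rpow_of_exponent_ge' (norm_nonneg _) hq1 (by linarith) (by linarith)

theorem exists_eventually_neg_le_inner_genHess (hC1 : CondC1 f g O γ τ xs)
    (hC2 : CondC2 f g γ xs) (hO : O ∈ 𝓝 xs) (hR : LocSingleLip (residual f g γ) xs)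
    (hxs : xs ∈ zeroSet f g γ) : ∃ κ₁ ρ, 0 < κ₁ ∧ τ < ρ ∧ ∀ᶠ u in 𝓝 xs, ∀ H ∈ genHess f g γ u,
      ∀ w, -(κ₁ * infDist u (zeroSet f g γ) ^ ρ * ‖w‖ ^ 2) ≤ ⟪w, H w⟫ := by
  obtain ⟨ε, κ₁, ρ, hε, hκ₁, hτρ, -, h1⟩ := hC1
  obtain ⟨δ, hδ, h2⟩ := hC2
  refine ⟨κ₁, ρ, hκ₁, hτρ, ?_⟩
  filter_upwards [closedBall_mem_nhds xs hε, hO, hR.eventually_projSet_nonempty hxs,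
    eventually_projSet_subset hxs (closedBall_mem_nhds xs hδ)]
    with u huε huO ⟨ub, hub⟩ hδ H hH w
  obtain ⟨Hb, hHb, hdist⟩ := h1 u ⟨huε, huO⟩ ub hub H hH
  have hpos : 0 ≤ ⟪w, Hb w⟫ := h2 ub ⟨hub.1, hδ hub⟩ Hb hHb w
  have hpert : |⟪w, (H - Hb) w⟫| ≤ κ₁ * infDist u (zeroSet f g γ) ^ ρ * ‖w‖ ^ 2 := by
    calc |⟪w, (H - Hb) w⟫| ≤ ‖w‖ * ‖(H - Hb) w‖ := abs_real_inner_le_norm _ _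
      _ ≤ ‖w‖ * (κ₁ * infDist u (zeroSet f g γ) ^ ρ * ‖w‖) := by
        gcongr
        exact (H - Hb).le_of_opNorm_le (hub.2 ▸ hdist) w
      _ = _ := by ring
  have hsplit : ⟪w, H w⟫ = ⟪w, Hb w⟫ + ⟪w, (H - Hb) w⟫ := by
    rw [_root_.sub_apply, inner_sub_right, add_sub_cancel]
  linarith [neg_le_of_abs_le hpert]

theorem eventually_genHess_coercive {σ : ℝ} (hC1 : CondC1 f g O γ τ xs)
    (hC2 : CondC2 f g γ xs) (hO : O ∈ 𝓝 xs) (hR : LocSingleLip (residual f g γ) xs)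
    (hxs : xs ∈ zeroSet f g γ) (hκ : 0 ≤ κ)
    (herr : ∀ᶠ u in 𝓝 xs, infDist u (zeroSet f g γ) ≤ κ * ‖val (residual f g γ) u‖)
    (hτ : 0 ≤ τ) (hσ : 0 < σ) :
    ∀ᶠ u in 𝓝 xs, ∀ H ∈ genHess f g γ u, ∀ a, σ * ‖val (residual f g γ) u‖ ^ τ ≤ a →
      ∀ w, a / 2 * ‖w‖ ^ 2 ≤ ⟪w, H w + a • w⟫ := by
  obtain ⟨κ₁, ρ, hκ₁, hτρ, hH⟩ := exists_eventually_neg_le_inner_genHess hC1 hC2 hO hR hxs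
  filter_upwards [hH, eventually_mul_infDist_rpow_le_mul_norm_rpow hxs herr hκ hκ₁.le hτ hτρ
    (half_pos hσ)] with u hu hsmall H hHu a ha w
  rw [inner_add_right, real_inner_smul_right, real_inner_self_eq_norm_sq]
  have hle : κ₁ * infDist u (zeroSet f g γ) ^ ρ * ‖w‖ ^ 2 ≤ a / 2 * ‖w‖ ^ 2 := by
    gcongr; linarith
  linarith [hu H hHu w]

/-- `d` solves the trust-region subproblem of the algorithm at `u`, with regularization `a • I`
and radius `r`, for some generalized Hessian `H ∈ ∂²F_γ(u)`. -/
def IsTrustRegionStep (f g : E n → EReal) (γ a r : ℝ) (u d : E n) : Prop :=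
  ‖d‖ ≤ r ∧ ∃ H ∈ genHess f g γ u, ∀ e, ‖e‖ ≤ r →
    quadModel H a (Q f γ u (val (residual f g γ) u)) d ≤
      quadModel H a (Q f γ u (val (residual f g γ) u)) e

namespace IsTrustRegionStep

variable {a r η : ℝ} {v : E n}

theorem norm_le (hd : IsTrustRegionStep f g γ a r u d) (hb : BasicAssumptions f g O L)
    (hγ : 0 < γ) (hu : u ∈ O) (ha : 0 < a)
    (hcoer : ∀ H ∈ genHess f g γ u, ∀ w, a / 2 * ‖w‖ ^ 2 ≤ ⟪w, H w + a • w⟫) (hv : ‖v‖ ≤ r)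
    (hη : ∀ J ∈ clarke (val (residual f g γ)) u, ‖val (residual f g γ) u + J v‖ ≤ η) :
    ‖d‖ ≤ 4 * ((1 + γ * L) * η / a) + 5 * ‖v‖ := by
  obtain ⟨-, H, hH, hmin⟩ := hd
  obtain ⟨J, hJ, hHJ⟩ := exists_mem_clarke_residual_of_mem_genHess hb hu hH
  have hL := hb.L_pos
  have hclose := norm_sub_le_of_quadratic_le (half_pos ha)
    (isSymmetric_add_smul_id a (isSelfAdjoint_of_mem_genHess hb hγ hu hH)) (hcoer H hH)
    (hmin v hv)
  have hgrad : ‖(H + a • .id ℝ (E n)) v + Q f γ u (val (residual f g γ) u)‖ ≤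
      (1 + γ * L) * η + a * ‖v‖ := by
    have heq : (H + a • .id ℝ (E n)) v + Q f γ u (val (residual f g γ) u) =
        Q f γ u (val (residual f g γ) u + J v) + a • v := by
      rw [hHJ, map_add, add_comm (Q f γ u _), add_right_comm]; rfl
    rw [heq]
    refine (norm_add_le _ _).trans ?_
    rw [norm_smul, Real.norm_of_nonneg ha.le]
    gcongr
    exact (hb.norm_Q_apply_le hγ.le hu _).trans (by gcongr; exact hη J hJ)
  calc ‖d‖ ≤ ‖d - v‖ + ‖v‖ := norm_le_norm_sub_add d v
    _ ≤ 2 / (a / 2) * ((1 + γ * L) * η + a * ‖v‖) + ‖v‖ := by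
      gcongr; exact hclose.trans (by gcongr)
    _ = 4 * ((1 + γ * L) * η / a) + 5 * ‖v‖ := by field_simp; ring

theorem exists_newton_equation (hd : IsTrustRegionStep f g γ a r u d)
    (hb : BasicAssumptions f g O L) (hγ : 0 < γ) (hu : u ∈ O) (hdr : ‖d‖ < r) :
    ∃ J ∈ clarke (val (residual f g γ)) u,
      Q f γ u (val (residual f g γ) u + J d) = -(a • d) := by
  obtain ⟨-, H, hH, hmin⟩ := hd
  obtain ⟨J, hJ, hHJ⟩ := exists_mem_clarke_residual_of_mem_genHess hb hu hH
  have hlocal : ∀ᶠ e in 𝓝 d, ‖e‖ ≤ r :=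
    (continuous_norm.tendsto d).eventually (eventually_le_nhds hdr)
  have hzero := eq_zero_of_isLocalMin_quadratic
    (isSymmetric_add_smul_id a (isSelfAdjoint_of_mem_genHess hb hγ hu hH)) (hlocal.mono hmin)
  refine ⟨J, hJ, ?_⟩
  rw [eq_neg_iff_add_eq_zero, ← hzero, hHJ, map_add, add_comm (Q f γ u _), add_right_comm]
  rfl

theorem exists_norm_residual_add_le (hd : IsTrustRegionStep f g γ a r u d)
    (hb : BasicAssumptions f g O L) (hγ : 0 < γ) (hγL : γ * L < 1) (hu : u ∈ O) (ha : 0 ≤ a)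
    (hdr : ‖d‖ < r) : ∃ J ∈ clarke (val (residual f g γ)) u,
      ‖val (residual f g γ) u + J d‖ ≤ a * ‖d‖ / (1 - γ * L) := by
  obtain ⟨J, hJ, heq⟩ := hd.exists_newton_equation hb hγ hu hdr
  have hle := hb.le_norm_Q_apply hγ.le hu (val (residual f g γ) u + J d)
  rw [heq, norm_neg, norm_smul, Real.norm_of_nonneg ha] at hle
  exact ⟨J, hJ, by rwa [le_div_iff₀' (sub_pos.2 hγL)]⟩

end IsTrustRegionStep

theorem exists_eventually_norm_trustRegionStep_le {σ : ℝ} (hb : BasicAssumptions f g O L)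
    (hγ : 0 < γ) (hO : O ∈ 𝓝 xs) (hxs : xs ∈ zeroSet f g γ) (hκ : 0 < κ)
    (herr : ∀ᶠ u in 𝓝 xs, infDist u (zeroSet f g γ) ≤ κ * ‖val (residual f g γ) u‖)
    (hτ : 0 ≤ τ) (hσ : 0 < σ) (hC1 : CondC1 f g O γ τ xs) (hC2 : CondC2 f g γ xs)
    (hC3 : CondC3 f g O γ τ xs) :
    ∃ C, 0 < C ∧ ∀ᶠ u in 𝓝 xs, 0 < infDist u (zeroSet f g γ) → ∀ a r d,
      σ * ‖val (residual f g γ) u‖ ^ τ ≤ a → infDist u (zeroSet f g γ) ≤ r →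
      IsTrustRegionStep f g γ a r u d → ‖d‖ ≤ C * infDist u (zeroSet f g γ) := by
  have hR := hC3.locSingleLip_residual (mem_of_mem_nhds hO)
  have hL := hb.L_pos
  obtain ⟨κ₂, hκ₂, hss⟩ := hC3.exists_eventually_clarkeRemainderLE hO hτ
  refine ⟨4 * ((1 + γ * L) * κ₂ * κ ^ τ / σ) + 5, by positivity, ?_⟩
  filter_upwards [hO, herr, eventually_genHess_coercive hC1 hC2 hO hR hxs hκ.le herr hτ hσ,
    hR.eventually_projSet_nonempty hxs, eventually_projSet_subset hxs hR.eventually,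
    eventually_forall_mem_projSet hxs hss]
    with u hu hδR hcoer ⟨ub, hub⟩ hloc hproj hδ a r d ha hr hd
  have hv : ‖ub - u‖ = infDist u (zeroSet f g γ) := by rw [norm_sub_rev, hub.2]
  have hmodel : ∀ J ∈ clarke (val (residual f g γ)) u,
      ‖val (residual f g γ) u + J (ub - u)‖ ≤ κ₂ * infDist u (zeroSet f g γ) ^ (1 + τ) := by
    intro J hJ
    have hle := hproj ub hub J hJ
    rwa [val_residual_eq_zero (hloc hub) hub.1, zero_sub, ← neg_add', norm_neg, hv] at hle
  have hRpos : 0 < ‖val (residual f g γ) u‖ := pos_of_mul_pos_right (hδ.trans_le hδR) hκ.le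
  have hapos : 0 < a := ha.trans_lt' (by positivity)
  have hratio : infDist u (zeroSet f g γ) ^ τ / a ≤ κ ^ τ / σ := by
    rw [div_le_div_iff₀ hapos hσ]
    calc infDist u (zeroSet f g γ) ^ τ * σ ≤ (κ * ‖val (residual f g γ) u‖) ^ τ * σ := by gcongr
      _ = κ ^ τ * (σ * ‖val (residual f g γ) u‖ ^ τ) := by
        rw [Real.mul_rpow hκ.le hRpos.le]; ring
      _ ≤ κ ^ τ * a := by gcongr
  have hnorm := hd.norm_le hb hγ hu hapos (fun H hH => hcoer H hH a ha) (hv.trans_le hr) hmodel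
  rw [hv, Real.rpow_add hδ, Real.rpow_one] at hnorm
  set δ := infDist u (zeroSet f g γ)
  calc ‖d‖ ≤ 4 * ((1 + γ * L) * (κ₂ * (δ * δ ^ τ)) / a) + 5 * δ := hnorm
    _ = (4 * ((1 + γ * L) * κ₂ * (δ ^ τ / a)) + 5) * δ := by ring
    _ ≤ (4 * ((1 + γ * L) * κ₂ * (κ ^ τ / σ)) + 5) * δ := by gcongr
    _ = _ := by ring

theorem exists_eventually_norm_residual_add_trustRegionStep_le {ϱ σlo σhi ςlo : ℝ}
    (hb : BasicAssumptions f g O L) (hγ : 0 < γ) (hγL : γ * L < 1) (hO : O ∈ 𝓝 xs)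
    (hxs : xs ∈ zeroSet f g γ) (hκ : 0 < κ)
    (herr : ∀ᶠ u in 𝓝 xs, infDist u (zeroSet f g γ) ≤ κ * ‖val (residual f g γ) u‖)
    (hτ : 0 ≤ τ) (hϱ : 0 ≤ ϱ) (hϱ1 : ϱ < 1) (hσlo : 0 < σlo) (hσhi : 0 ≤ σhi) (hςlo : 0 < ςlo)
    (hC1 : CondC1 f g O γ τ xs) (hC2 : CondC2 f g γ xs) (hC3 : CondC3 f g O γ τ xs) :
    ∃ C, 0 < C ∧ ∀ᶠ u in 𝓝 xs, 0 < infDist u (zeroSet f g γ) → ∀ a r d,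
      σlo * ‖val (residual f g γ) u‖ ^ τ ≤ a → a ≤ σhi * ‖val (residual f g γ) u‖ ^ τ →
      ςlo * ‖val (residual f g γ) u‖ ^ ϱ ≤ r → IsTrustRegionStep f g γ a r u d →
      ‖val (residual f g γ) (u + d)‖ ≤ C * infDist u (zeroSet f g γ) ^ (1 + τ) := by
  have hR := hC3.locSingleLip_residual (mem_of_mem_nhds hO)
  obtain ⟨K, hK, hRle⟩ := hR.exists_norm_val_residual_le hxs
  obtain ⟨C, hC, hnorm⟩ :=
    exists_eventually_norm_trustRegionStep_le hb hγ hO hxs hκ herr hτ hσlo hC1 hC2 hC3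
  obtain ⟨κ₂, hκ₂, hss⟩ := hC3.exists_eventually_clarkeRemainderLE hO hτ
  refine ⟨κ₂ * C ^ (1 + τ) + σhi * K ^ τ * C / (1 - γ * L), by positivity, ?_⟩
  filter_upwards [hO, hRle, hnorm, eventually_forall_of_dist_le_mul_infDist hxs C hss,
    eventually_mul_infDist_rpow_le_mul_norm_rpow hxs herr hκ.le (by positivity : 0 ≤ C + 1)
      hϱ hϱ1 hςlo] with u hu huK hnorm hss hinterior hδ a r d haσ haσ' hr hd
  rw [Real.rpow_one, add_one_mul] at hinterior
  have hδr := hinterior.trans hr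
  have hdC : ‖d‖ ≤ C * infDist u (zeroSet f g γ) := hnorm hδ a r d haσ (by nlinarith) hd
  obtain ⟨J, hJ, hnewton⟩ := hd.exists_norm_residual_add_le hb hγ hγL hu
    (haσ.trans' (by positivity)) (by linarith)
  have herror := hss (u + d) (by rwa [dist_eq_norm, add_sub_cancel_left]) J hJ
  rw [add_sub_cancel_left] at herror
  set δ := infDist u (zeroSet f g γ)
  set R := val (residual f g γ)
  calc ‖R (u + d)‖ = ‖(R (u + d) - R u - J d) + (R u + J d)‖ := by congr 1; abel
    _ ≤ κ₂ * ‖d‖ ^ (1 + τ) + a * ‖d‖ / (1 - γ * L) := norm_add_le_of_le herror hnewton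
    _ ≤ κ₂ * (C * δ) ^ (1 + τ) + σhi * (K * δ) ^ τ * (C * δ) / (1 - γ * L) := by
      gcongr
      exact haσ'.trans (by gcongr)
    _ = _ := by
      rw [Real.mul_rpow hC.le hδ.le, Real.mul_rpow hK hδ.le, Real.rpow_add hδ, Real.rpow_one]
      ring

end NewtonDirection

theorem BasicAssumptions.mem_nhds_of_mem_zeroSet {f g : E n → EReal} {O : Set (E n)} {L γ : ℝ}
    {xs : E n} (h : BasicAssumptions f g O L) (hγ : γ ≠ 0) (hxs : xs ∈ zeroSet f g γ) : O ∈ 𝓝 xs :=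
  h.isOpen.mem_nhds (h.mem_of_mem_fbStep ((mem_zeroSet_iff hγ).1 hxs))

namespace Params.Admissible

variable {p : Params} {L : ℝ}

theorem γstar_pos (hp : p.Admissible L) (hL : 0 < L) : 0 < p.γstar L :=
  inv_pos.2 (add_pos hL (mul_pos two_pos hp.α_pos))

theorem γstar_mul_lt_one (hp : p.Admissible L) (hL : 0 < L) : p.γstar L * L < 1 := by
  have hα := hp.α_pos
  rw [Params.γstar, inv_mul_lt_one₀ (by positivity)]
  linarith

end Params.Admissible

namespace IsRun

variable {f g : E n → EReal} {O : Set (E n)} {L : ℝ} {p : Params} {it : Iterates n} {xs : E n}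

theorem γstar_le (hrun : IsRun f g O L p it) (hp : p.Admissible L) (hL : 0 < L) (k : ℕ) :
    p.γstar L ≤ it.γ k := by
  have hα := hp.α_pos
  refine le_trans ?_ (hrun.γ_mem k).1
  rw [Params.γstar, one_div]
  gcongr
  linarith

theorem isTrustRegionStep (hrun : IsRun f g O L p it) (k : ℕ) :
    IsTrustRegionStep f g (it.γt p L k) (‖it.res f g p L k‖ ^ p.τ * it.σ k)
      (it.ς k * ‖it.res f g p L k‖ ^ p.ϱ) (it.x k) (it.d k) :=
  ⟨hrun.d_mem k, it.H k, hrun.H_mem k, hrun.d_min k⟩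

theorem eventually_γt_eq (hrun : IsRun f g O L p it) (hγ : 0 < p.γstar L)
    (hx : Tendsto it.x atTop (𝓝 xs)) (hR : LocSingleLip (residual f g (p.γstar L)) xs) :
    ∀ᶠ k in atTop, it.γt p L k = p.γstar L := by
  filter_upwards [hx.eventually (hR.fbStep_of_residual hγ).eventually] with k hk
  have hm : it.m k ≤ 0 :=
    (hrun.m_least k).2 (by rwa [Set.mem_ofPred_eq, pow_zero, mul_one])
  rw [Iterates.γt, Nat.le_zero.1 hm, pow_zero, mul_one]

theorem tendsto_add_d (hrun : IsRun f g O L p it) (hp : p.Admissible L)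
    (hx : Tendsto it.x atTop (𝓝 xs)) (hxs : xs ∈ zeroSet f g (p.γstar L))
    (hR : LocSingleLip (residual f g (p.γstar L)) xs)
    (hγt : ∀ᶠ k in atTop, it.γt p L k = p.γstar L) :
    Tendsto (fun k => it.x k + it.d k) atTop (𝓝 xs) := by
  have hradius : Tendsto (fun k => p.ςhi * ‖val (residual f g (p.γstar L)) (it.x k)‖ ^ p.ϱ) atTop
      (𝓝 0) := by
    have hres : Tendsto (fun k => ‖val (residual f g (p.γstar L)) (it.x k)‖) atTop (𝓝 0) := by
      simpa only [val_residual_eq_zero hR hxs, norm_zero, Function.comp_apply] using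
        (hR.continuousAt.tendsto.comp hx).norm
    simpa only [Real.zero_rpow hp.ϱ_pos.ne', mul_zero] using
      (hres.rpow_const (Or.inr hp.ϱ_pos.le)).const_mul p.ςhi
  have hd : Tendsto it.d atTop (𝓝 0) := by
    refine squeeze_zero_norm' ?_ hradius
    filter_upwards [hγt] with k hk
    have hdk := hrun.d_mem k
    rw [Iterates.res, hk] at hdk
    exact hdk.trans (by gcongr; exact (hrun.ς_mem k).2)
  simpa only [add_zero] using hx.add hd

theorem eventually_objective_add_le_fbe_y (hrun : IsRun f g O L p it) (hp : p.Admissible L)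
    (hL : 0 < L) (hx : Tendsto it.x atTop (𝓝 xs)) (hmin : IsLocalMin (objective f g) xs) :
    ∀ᶠ k in atTop, objective f g xs + ((p.α / 2 * ‖it.x k - it.y k‖ ^ 2 : ℝ) : EReal) ≤
      fbe f g (p.γstar L) (it.y k) := by
  filter_upwards [hx.eventually hmin] with k hk
  have hdesc := hk.trans (hrun.x_descent k)
  rw [EReal.le_sub_iff_add_le (Or.inl (EReal.coe_ne_bot _)) (Or.inl (EReal.coe_ne_top _))] at hdesc
  exact hdesc.trans (fbe_antitone (hp.γstar_pos hL) (hrun.γstar_le hp hL k) _)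

theorem eventually_objective_lt_fbe_y (hrun : IsRun f g O L p it) (hp : p.Admissible L)
    (hb : BasicAssumptions f g O L) (h4 : LocalAssumptions f g O (p.γstar L) it.x xs) :
    ∀ᶠ k in atTop, objective f g xs < fbe f g (p.γstar L) (it.y k) := by
  obtain ⟨c, hc⟩ := hb.exists_objective_eq_coe (hp.γstar_pos hb.L_pos).ne' h4.mem
  filter_upwards [hrun.eventually_objective_add_le_fbe_y hp hb.L_pos h4.tendsto h4.localMin]
    with k hk
  have hstep : 0 < ‖it.x k - it.y k‖ := norm_pos_iff.2 (sub_ne_zero.2 (hrun.not_stop k))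
  have hα := hp.α_pos
  refine lt_of_lt_of_le ?_ hk
  rw [hc, ← EReal.coe_add, EReal.coe_lt_coe_iff, lt_add_iff_pos_right]
  positivity

theorem eventually_infDist_y_pos (hrun : IsRun f g O L p it) (hp : p.Admissible L)
    (hb : BasicAssumptions f g O L) (h4 : LocalAssumptions f g O (p.γstar L) it.x xs)
    (hR : LocSingleLip (residual f g (p.γstar L)) xs) (hy : Tendsto it.y atTop (𝓝 xs)) :
    ∀ᶠ k in atTop, 0 < infDist (it.y k) (zeroSet f g (p.γstar L)) := by
  filter_upwards [hrun.eventually_objective_lt_fbe_y hp hb h4, hy.eventually hR.eventually,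
    hy.eventually (h4.eventually_fbe_eq hb (hp.γstar_pos hb.L_pos))] with k hlt hloc hconst
  refine infDist_nonneg.lt_of_ne' fun h0 => hlt.ne' ?_
  exact hconst (hloc.mem_zeroSet_of_infDist_eq_zero ⟨xs, h4.mem⟩ h0)

-- If `x^k ∈ X*`, the line search would give `F_*(y^{k+1}) ≤ F_*(x^k) = F(x*)`.
theorem eventually_infDist_x_pos (hrun : IsRun f g O L p it) (hp : p.Admissible L)
    (hb : BasicAssumptions f g O L) (h4 : LocalAssumptions f g O (p.γstar L) it.x xs)
    (hR : LocSingleLip (residual f g (p.γstar L)) xs)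
    (hγt : ∀ᶠ k in atTop, it.γt p L k = p.γstar L) :
    ∀ᶠ k in atTop, 0 < infDist (it.x k) (zeroSet f g (p.γstar L)) := by
  have hγ := hp.γstar_pos hb.L_pos
  have hγL := hp.γstar_mul_lt_one hb.L_pos
  obtain ⟨c, hc⟩ := hb.exists_objective_eq_coe hγ.ne' h4.mem
  filter_upwards [h4.tendsto.eventually hR.eventually,
    h4.tendsto.eventually (h4.eventually_fbe_eq hb hγ), hγt,
    (tendsto_add_atTop_nat 1).eventually (hrun.eventually_objective_lt_fbe_y hp hb h4)]
    with k hloc hconst hk hlt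
  refine infDist_nonneg.lt_of_ne' fun h0 => hlt.not_ge ?_
  have haccept := (hrun.l_least k).1.2
  rw [← hrun.y_succ k, hk, hconst (hloc.mem_zeroSet_of_infDist_eq_zero ⟨xs, h4.mem⟩ h0), hc,
    ← EReal.coe_sub] at haccept
  refine haccept.trans (hc ▸ EReal.coe_le_coe_iff.2 (sub_le_self _ ?_))
  have hgap : 0 ≤ p.γstar L - p.γstar L ^ 2 * L := by nlinarith
  positivity

theorem exists_infDist_add_d_le (hrun : IsRun f g O L p it) (hp : p.Admissible L)
    (hb : BasicAssumptions f g O L) (h4 : LocalAssumptions f g O (p.γstar L) it.x xs)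
    (hC1 : CondC1 f g O (p.γstar L) p.τ xs) (hC2 : CondC2 f g (p.γstar L) xs)
    (hC3 : CondC3 f g O (p.γstar L) p.τ xs) (hγt : ∀ᶠ k in atTop, it.γt p L k = p.γstar L)
    (hpos : ∀ᶠ k in atTop, 0 < infDist (it.x k) (zeroSet f g (p.γstar L))) :
    ∃ c, 0 < c ∧ ∀ᶠ k in atTop, infDist (it.x k + it.d k) (zeroSet f g (p.γstar L)) ≤
      c * infDist (it.x k) (zeroSet f g (p.γstar L)) ^ (1 + p.τ) := by
  have hγ := hp.γstar_pos hb.L_pos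
  have hO := hb.mem_nhds_of_mem_zeroSet hγ.ne' h4.mem
  have hR := hC3.locSingleLip_residual (mem_of_mem_nhds hO)
  obtain ⟨κ, hκ, herr⟩ := h4.exists_infDist_le hO hR
  obtain ⟨C, hC, hnewton⟩ := exists_eventually_norm_residual_add_trustRegionStep_le hb hγ
    (hp.γstar_mul_lt_one hb.L_pos) hO h4.mem hκ herr hp.τ_pos.le hp.ϱ_pos.le
    (by linarith [hp.ϱ_lt, hp.τ_pos]) hp.σlo_pos (hp.σlo_pos.trans hp.σlo_lt).le hp.ςlo_pos
    hC1 hC2 hC3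
  refine ⟨κ * C, by positivity, ?_⟩
  filter_upwards [hγt, hpos, h4.tendsto.eventually hnewton,
    (hrun.tendsto_add_d hp h4.tendsto h4.mem hR hγt).eventually herr] with k hk hposk hnk herrk
  have hstep := hrun.isTrustRegionStep k
  rw [Iterates.res, hk] at hstep
  obtain ⟨hσlo, hσhi⟩ := hrun.σ_mem k
  calc _ ≤ κ * ‖val (residual f g (p.γstar L)) (it.x k + it.d k)‖ := herrk
    _ ≤ κ * (C * infDist (it.x k) (zeroSet f g (p.γstar L)) ^ (1 + p.τ)) := by
      gcongr
      refine hnk hposk _ _ _ ?_ ?_ ?_ hstep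
      · rw [mul_comm]; gcongr
      · rw [mul_comm]; gcongr
      · gcongr; exact (hrun.ς_mem k).1
    _ = _ := (mul_assoc _ _ _).symm

theorem trial_zero (k : ℕ) : it.trial f g p L k 0 = it.x k + it.d k := by
  rw [Iterates.trial, pow_zero, one_smul, sub_self, zero_smul, add_zero]

theorem eventually_l_eq_zero {c : ℝ} (hrun : IsRun f g O L p it) (hp : p.Admissible L)
    (hb : BasicAssumptions f g O L) (h4 : LocalAssumptions f g O (p.γstar L) it.x xs)
    (hR : LocSingleLip (residual f g (p.γstar L)) xs)
    (hγt : ∀ᶠ k in atTop, it.γt p L k = p.γstar L)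
    (hstep : ∀ᶠ k in atTop, infDist (it.x k + it.d k) (zeroSet f g (p.γstar L)) ≤
      c * infDist (it.x k) (zeroSet f g (p.γstar L)) ^ (1 + p.τ)) :
    ∀ᶠ k in atTop, it.l k = 0 := by
  have hγ := hp.γstar_pos hb.L_pos
  have hO := hb.mem_nhds_of_mem_zeroSet hγ.ne' h4.mem
  have hxd := hrun.tendsto_add_d hp h4.tendsto h4.mem hR hγt
  obtain ⟨κ, hκ, herr⟩ := h4.exists_infDist_le hO hR
  have hdecrease := eventually_sufficient_decrease (c := c) hγ (hp.γstar_mul_lt_one hb.L_pos)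
    hb.L_pos.le hp.τ_pos h4.mem hκ.le herr
    (eventually_fbe_le hb hγ hO hR h4.mem (h4.eventually_fbe_eq hb hγ))
    (eventually_objective_add_le_fbe hb hγ hO hR h4.mem h4.localMin)
  filter_upwards [hγt, hstep, hxd.eventually hO, (h4.tendsto.prodMk hxd).eventually hdecrease]
    with k hk hle hmem hdec
  refine Nat.le_zero.1 ((hrun.l_least k).2 ?_)
  rw [Set.mem_ofPred_eq, trial_zero, Iterates.res, hk]
  exact ⟨hmem, hdec hle⟩

theorem eventually_y_succ_eq (hrun : IsRun f g O L p it) (hl : ∀ᶠ k in atTop, it.l k = 0) :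
    ∀ᶠ k in atTop, it.y (k + 1) = it.x k + it.d k :=
  hl.mono fun k hk => by rw [hrun.y_succ, hk, trial_zero]

theorem tendsto_y (hrun : IsRun f g O L p it)
    (hxd : Tendsto (fun k => it.x k + it.d k) atTop (𝓝 xs)) (hl : ∀ᶠ k in atTop, it.l k = 0) :
    Tendsto it.y atTop (𝓝 xs) :=
  (tendsto_add_atTop_iff_nat 1).1 (hxd.congr' (EventuallyEq.symm (hrun.eventually_y_succ_eq hl)))

theorem exists_infDist_x_le (hrun : IsRun f g O L p it) (hp : p.Admissible L)
    (hb : BasicAssumptions f g O L) (h4 : LocalAssumptions f g O (p.γstar L) it.x xs)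
    (hR : LocSingleLip (residual f g (p.γstar L)) xs) (hy : Tendsto it.y atTop (𝓝 xs)) :
    ∃ D, 0 < D ∧ ∀ᶠ k in atTop, infDist (it.x k) (zeroSet f g (p.γstar L)) ≤
      D * infDist (it.y k) (zeroSet f g (p.γstar L)) := by
  have hα := hp.α_pos
  have hL := hb.L_pos
  have hγ := hp.γstar_pos hL
  have hO := hb.mem_nhds_of_mem_zeroSet hγ.ne' h4.mem
  obtain ⟨c, hc⟩ := hb.exists_objective_eq_coe hγ.ne' h4.mem
  have hupper := eventually_fbe_le hb hγ hO hR h4.mem (h4.eventually_fbe_eq hb hγ)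
  set A := (2 * p.γstar L)⁻¹ + L / 2
  refine ⟨1 + √(2 * A / p.α), by positivity, ?_⟩
  filter_upwards [hrun.eventually_objective_add_le_fbe_y hp hL h4.tendsto h4.localMin,
    hy.eventually hupper] with k hlo hup
  have hsq := hlo.trans hup
  rw [hc, ← EReal.coe_add, ← EReal.coe_add, EReal.coe_le_coe_iff, add_le_add_iff_left] at hsq
  have hstep : ‖it.x k - it.y k‖ ≤
      √(2 * A / p.α) * infDist (it.y k) (zeroSet f g (p.γstar L)) := by
    refine le_of_sq_le_sq ?_ (mul_nonneg (Real.sqrt_nonneg _) infDist_nonneg)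
    rw [mul_pow, Real.sq_sqrt (by positivity), div_mul_eq_mul_div, le_div_iff₀ hα]
    linarith
  have htri := infDist_le_infDist_add_dist (s := zeroSet f g (p.γstar L)) (x := it.x k)
    (y := it.y k)
  rw [dist_eq_norm] at htri
  linarith

theorem exists_infDist_y_succ_le {c : ℝ} (hrun : IsRun f g O L p it) (hp : p.Admissible L)
    (hb : BasicAssumptions f g O L) (h4 : LocalAssumptions f g O (p.γstar L) it.x xs)
    (hR : LocSingleLip (residual f g (p.γstar L)) xs) (hy : Tendsto it.y atTop (𝓝 xs))
    (hl : ∀ᶠ k in atTop, it.l k = 0) (hc : 0 < c)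
    (hstep : ∀ᶠ k in atTop, infDist (it.x k + it.d k) (zeroSet f g (p.γstar L)) ≤
      c * infDist (it.x k) (zeroSet f g (p.γstar L)) ^ (1 + p.τ)) :
    ∃ c', 0 < c' ∧ ∀ᶠ k in atTop, infDist (it.y (k + 1)) (zeroSet f g (p.γstar L)) ≤
      c' * infDist (it.y k) (zeroSet f g (p.γstar L)) ^ (1 + p.τ) := by
  have hτ := hp.τ_pos
  obtain ⟨D, hD, hxy⟩ := hrun.exists_infDist_x_le hp hb h4 hR hy
  refine ⟨c * D ^ (1 + p.τ), by positivity, ?_⟩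
  filter_upwards [hrun.eventually_y_succ_eq hl, hstep, hxy] with k hsucc hle hle'
  rw [hsucc, mul_assoc, ← Real.mul_rpow hD.le infDist_nonneg]
  refine hle.trans ?_
  gcongr
  exact infDist_nonneg

end IsRun

end PGSSN

theorem theorem5p1_general {n : ℕ} (f g : PGSSN.E n → EReal) (O : Set (PGSSN.E n)) (L : ℝ)
    (p : PGSSN.Params) (it : PGSSN.Iterates n) (xs : PGSSN.E n)
    (hp : p.Admissible L)
    (hrun : PGSSN.IsRun f g O L p it)
    (h1 : PGSSN.BasicAssumptions f g O L)
    (h4 : PGSSN.LocalAssumptions f g O (p.γstar L) it.x xs)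
    (hC1 : PGSSN.CondC1 f g O (p.γstar L) p.τ xs)
    (hC2 : PGSSN.CondC2 f g (p.γstar L) xs)
    (hC3 : PGSSN.CondC3 f g O (p.γstar L) p.τ xs) :
    ∃ (c c' : ℝ) (K : ℕ), 0 < c ∧ 0 < c' ∧
      (∀ k > K, 0 < Metric.infDist (it.x k) (PGSSN.zeroSet f g (p.γstar L)) ∧
        Metric.infDist (it.x k + it.d k) (PGSSN.zeroSet f g (p.γstar L)) ≤
          c * Metric.infDist (it.x k) (PGSSN.zeroSet f g (p.γstar L)) ^ (1 + p.τ)) ∧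
      Tendsto (fun k => Metric.infDist (it.x k + it.d k) (PGSSN.zeroSet f g (p.γstar L)) /
        Metric.infDist (it.x k) (PGSSN.zeroSet f g (p.γstar L))) atTop (𝓝 0) ∧
      (∀ k > K, it.l k = 0) ∧
      Tendsto (fun k => Metric.infDist (it.y k) (PGSSN.zeroSet f g (p.γstar L))) atTop (𝓝 0) ∧
      (∀ k > K, 0 < Metric.infDist (it.y k) (PGSSN.zeroSet f g (p.γstar L)) ∧
        Metric.infDist (it.y (k + 1)) (PGSSN.zeroSet f g (p.γstar L)) ≤
          c' * Metric.infDist (it.y k) (PGSSN.zeroSet f g (p.γstar L)) ^ (1 + p.τ)) ∧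
      Tendsto (fun k => Metric.infDist (it.y (k + 1)) (PGSSN.zeroSet f g (p.γstar L)) /
        Metric.infDist (it.y k) (PGSSN.zeroSet f g (p.γstar L))) atTop (𝓝 0) := by
  have hγ := hp.γstar_pos h1.L_pos
  have hR := hC3.locSingleLip_residual (mem_of_mem_nhds (h1.mem_nhds_of_mem_zeroSet hγ.ne' h4.mem))
  have hγt := hrun.eventually_γt_eq hγ h4.tendsto hR
  have hx_pos := hrun.eventually_infDist_x_pos hp h1 h4 hR hγt
  obtain ⟨c, hc, hstep⟩ := hrun.exists_infDist_add_d_le hp h1 h4 hC1 hC2 hC3 hγt hx_pos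
  have hl := hrun.eventually_l_eq_zero hp h1 h4 hR hγt hstep
  have hy := hrun.tendsto_y (hrun.tendsto_add_d hp h4.tendsto h4.mem hR hγt) hl
  have hy_pos := hrun.eventually_infDist_y_pos hp h1 h4 hR hy
  obtain ⟨c', hc', hstep'⟩ := hrun.exists_infDist_y_succ_le hp h1 h4 hR hy hl hc hstep
  have hx_lim := (PGSSN.tendsto_infDist_nhds h4.mem).comp h4.tendsto
  have hy_lim := (PGSSN.tendsto_infDist_nhds h4.mem).comp hy
  obtain ⟨K, hK⟩ :=
    eventually_atTop.1 (hx_pos.and (hstep.and (hl.and (hy_pos.and hstep'))))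
  refine ⟨c, c', K, hc, hc', fun k hk => ?_, ?_, fun k hk => ?_, hy_lim, fun k hk => ?_, ?_⟩
  · exact ⟨(hK k hk.le).1, (hK k hk.le).2.1⟩
  · exact PGSSN.tendsto_div_of_le_const_mul_rpow hp.τ_pos
      (.of_forall fun _ => Metric.infDist_nonneg) hx_lim hx_pos hstep
  · exact (hK k hk.le).2.2.1
  · exact (hK k hk.le).2.2.2
  · exact PGSSN.tendsto_div_of_le_const_mul_rpow hp.τ_pos
      (.of_forall fun _ => Metric.infDist_nonneg) hy_lim hy_pos hstep'

theorem theorem5p1 {n : ℕ} (f g : PGSSN.E n → EReal) (O : Set (PGSSN.E n)) (L : ℝ)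
    (p : PGSSN.Params) (it : PGSSN.Iterates n) (xs : PGSSN.E n)
    (hp : p.Admissible L)
    (hrun : PGSSN.IsRun f g O L p it)
    (h1 : PGSSN.BasicAssumptions f g O L)
    (h2 : PGSSN.ProxAssumptions g L)
    (h3 : Bornology.IsBounded (Set.range it.x))
    (h4 : PGSSN.LocalAssumptions f g O (p.γstar L) it.x xs)
    (hC1 : PGSSN.CondC1 f g O (p.γstar L) p.τ xs)
    (hC2 : PGSSN.CondC2 f g (p.γstar L) xs)
    (hC3 : PGSSN.CondC3 f g O (p.γstar L) p.τ xs) :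
    ∃ (c c' : ℝ) (K : ℕ), 0 < c ∧ 0 < c' ∧
      (∀ k > K, 0 < Metric.infDist (it.x k) (PGSSN.zeroSet f g (p.γstar L)) ∧
        Metric.infDist (it.x k + it.d k) (PGSSN.zeroSet f g (p.γstar L)) ≤
          c * Metric.infDist (it.x k) (PGSSN.zeroSet f g (p.γstar L)) ^ (1 + p.τ)) ∧
      Tendsto (fun k => Metric.infDist (it.x k + it.d k) (PGSSN.zeroSet f g (p.γstar L)) /
        Metric.infDist (it.x k) (PGSSN.zeroSet f g (p.γstar L))) atTop (𝓝 0) ∧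
      (∀ k > K, it.l k = 0) ∧
      Tendsto (fun k => Metric.infDist (it.y k) (PGSSN.zeroSet f g (p.γstar L))) atTop (𝓝 0) ∧
      (∀ k > K, 0 < Metric.infDist (it.y k) (PGSSN.zeroSet f g (p.γstar L)) ∧
        Metric.infDist (it.y (k + 1)) (PGSSN.zeroSet f g (p.γstar L)) ≤
          c' * Metric.infDist (it.y k) (PGSSN.zeroSet f g (p.γstar L)) ^ (1 + p.τ)) ∧
      Tendsto (fun k => Metric.infDist (it.y (k + 1)) (PGSSN.zeroSet f g (p.γstar L)) /
        Metric.infDist (it.y k) (PGSSN.zeroSet f g (p.γstar L))) atTop (𝓝 0) := by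
  exact theorem5p1_general f g O L p it xs hp hrun h1 h4 hC1 hC2 hC3
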